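/- There are an integer $c\ge 1$, a constant $A$ and an algorithm (one fixed program of a unit-cost random access machine whose only arithmetic operations are $+1$ and $-1$) with the following properties. Given an instance $(G,k)$ of Clique, that is, an undirected simple graph $G$ on $n\ge 0$ vertices, presented by its adjacency matrix, and an integer $k\ge 0$, the algorithm halts after at most $A\cdot 2^k\cdot (n+1)^{A}$ steps (that is, it works in time $2^k\cdot n^{O(1)}$). It outputs an instance $(\mathcal{C},L,d)$ of Closest String over the alphabet $\{0,1\}$, that is, nonnegative integers $L$ and $d$ and a finite family $\mathcal{C}$ of strings from $\{0,1\}^L$, written out letter by letter. Denoting by $\mathrm{H}(w,x)$ the Hamming distance, the number of positions at which $w$ and $x$ differ, this instance satisfies: - If $G$ contains a clique on $k$ vertices, then there is a string $w\in\{0,1\}^L$ such that $\mathrm{H}(w,x)\le d$ for each $x\in\mathcal{C}$. - If $G$ does not contain a clique on $k$ vertices (so that $k\ge 1$), then for each string $w\in\{0,1\}^L$ there is $x\in\mathcal{C}$ such that $\mathrm{H}(w,x)>\left(1+\frac{1}{ck}\right)\cdot d$. -/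

import Mathlib

/-!
A successor random access machine with unit cost, the input and output conventions of the
reduction, and Closest String instances over the binary alphabet.
-/

namespace SuccRAM

/-- A machine state: registers, random access memory (divided into banks, the bank being named in
the program and the address computed at run time), and an append-only output. -/
structure State where
  reg : ℕ → ℕ
  mem : ℕ → ℕ → ℕ
  out : List ℕ

/-- The elementary instructions. There is deliberately no unit-cost addition or multiplication:
during a run of `t` steps no number exceeds `t` plus the largest number in the input or in the
program, so that charging one unit per step is realistic. -/
inductive Instr where
  /-- `reg x := c` -/
  | const (x c : ℕ)
  /-- `reg x := reg y` -/
  | copy (x y : ℕ)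
  /-- `reg x := reg x + 1` -/
  | inc (x : ℕ)
  /-- `reg x := reg x - 1`, or `0` if `reg x = 0` -/
  | dec (x : ℕ)
  /-- `reg x := mem b [reg i]` -/
  | load (x b i : ℕ)
  /-- `mem b [reg i] := reg x` -/
  | store (b i x : ℕ)
  /-- append `reg x` to the output -/
  | emit (x : ℕ)

/-- The effect of an elementary instruction. -/
def Instr.apply : Instr → State → State
  | .const x c, s => { s with reg := Function.update s.reg x c }
  | .copy x y, s => { s with reg := Function.update s.reg x (s.reg y) }
  | .inc x, s => { s with reg := Function.update s.reg x (s.reg x + 1) }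
  | .dec x, s => { s with reg := Function.update s.reg x (s.reg x - 1) }
  | .load x b i, s => { s with reg := Function.update s.reg x (s.mem b (s.reg i)) }
  | .store b i x, s =>
      { s with mem := Function.update s.mem b (Function.update (s.mem b) (s.reg i) (s.reg x)) }
  | .emit x, s => { s with out := s.out ++ [s.reg x] }

/-- Tests comparing two registers. -/
inductive Test where
  | lt (x y : ℕ)
  | eq (x y : ℕ)

/-- The meaning of a test in a state. -/
def Test.Holds : Test → State → Prop
  | .lt x y, s => s.reg x < s.reg y
  | .eq x y, s => s.reg x = s.reg y

/-- Programs: finite pieces of structured code. -/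
inductive Prog where
  | instr (a : Instr)
  | seq (p q : Prog)
  | ite (b : Test) (p q : Prog)
  | while (b : Test) (p : Prog)

/-- `Run p s t s'`: started in state `s`, the program `p` halts in state `s'` after exactly `t`
steps, where each execution of an instruction and each evaluation of a test is one step. -/
inductive Run : Prog → State → ℕ → State → Prop where
  | instr (a : Instr) (s : State) : Run (.instr a) s 1 (a.apply s)
  | seq {p q : Prog} {s s' s'' : State} {t t' : ℕ} :
      Run p s t s' → Run q s' t' s'' → Run (.seq p q) s (t + t') s''
  | ite_true {b : Test} {p q : Prog} {s s' : State} {t : ℕ} :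
      b.Holds s → Run p s t s' → Run (.ite b p q) s (1 + t) s'
  | ite_false {b : Test} {p q : Prog} {s s' : State} {t : ℕ} :
      ¬ b.Holds s → Run q s t s' → Run (.ite b p q) s (1 + t) s'
  | while_true {b : Test} {p : Prog} {s s' s'' : State} {t t' : ℕ} :
      b.Holds s → Run p s t s' → Run (.while b p) s' t' s'' →
        Run (.while b p) s (1 + t + t') s''
  | while_false {b : Test} {p : Prog} {s : State} :
      ¬ b.Holds s → Run (.while b p) s 1 s

end SuccRAM

/-- An instance of the decision version of Closest String over the alphabet `{0,1}`: a family of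
strings of common length `len`, and a target distance `dist`. -/
structure ClosestStringInstance where
  len : ℕ
  strings : List (Fin len → Bool)
  dist : ℕ

/-- The encoding of a Closest String instance on the output: the length, the target distance, and
then the strings one after the other, written letter by letter (as `0` and `1`), each followed by
the end mark `2`. -/
def ClosestStringInstance.encode (I : ClosestStringInstance) : List ℕ :=
  I.len :: I.dist :: I.strings.flatMap fun x => List.ofFn (fun j => (x j).toNat) ++ [2]

open Classical in
/-- The initial state for a Clique instance `(G, k)`, where `G` has the vertices `0, …, n - 1`:
register `0` holds `n`, register `1` holds `k`, memory bank `0` holds the adjacency matrix of `G`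
row by row, everything else is zero, and the output is empty. -/
noncomputable def cliqueInput {n : ℕ} (G : SimpleGraph (Fin n)) (k : ℕ) : SuccRAM.State where
  reg r := if r = 0 then n else if r = 1 then k else 0
  mem b a := if b = 0 ∧ ∃ u v : Fin n, G.Adj u v ∧ a = u * n + v then 1 else 0
  out := []

/-! Let `m` exceed the binary length of `n` by one. Every vertex `v` receives a code word of length
`16 * m` that contains exactly `8 * m` ones, and distinct vertices have code words at distance at
least `2 * m`. A center is cut into `k` blocks of length `16 * m`, block `i` being meant to hold the
code word of the `i`-th clique vertex. For blocks `i < j` and words `x`, `y` that are not jointly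
close to the code words of any edge, and for each bit `b`, there is a string with the complement of
`x` in block `i`, the complement of `y` in block `j` and the constant `b` elsewhere. A center formed
from a clique gets `8 * m` from each constant block, and at most `32 * m - m` from the two special
blocks, hence at most `d = 8 * m * k + 15 * m` in total. Conversely, if the blocks `i`, `j` of a
center are such a pair `x`, `y`, the special blocks give all `32 * m`, and one of the two values of
`b` gives at least half of the remaining letters, in total `d + m`, which exceeds `(1 + 1 / (24 *
k)) * d`. If no pair of blocks is of this kind, each pair is close to the code words of an edge; the
code distance makes the vertex of each block unique, so these vertices form a clique. The code is an
affine hash `a ↦ (x * a + y) % p` followed by its complement, which balances it. A union bound over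
pairs of vertices shows that a good seed exists. Since `2 ^ m` is linear in `n`, exhaustive search
for the seed and enumeration of all `x`, `y` are polynomial in `n + k`; the factor `2 ^ k` only
absorbs a power of `k`. The machine side is a calculus of polynomial-time functions, closed under
bounded recursion and bounded loops, so that no explicit program has to be analysed. -/

namespace SuccRAM

/-! ### Functions computed by the machine -/

/-- A type of contexts: a context provides `depth` numbers held in registers, a table held in
memory bank `0` with entries at most `1`, and a size that bounds the numbers. -/
class Ctx (Γ : Type) where
  depth : ℕ
  val : Γ → ℕ → ℕ
  table : Γ → ℕ → ℕ
  size : Γ → ℕ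
  val_le : ∀ γ, ∀ i < depth, val γ i ≤ size γ
  table_le : ∀ γ a, table γ a ≤ 1

/-- A context extended by one more number. -/
instance Ctx.prod (Γ : Type) [Ctx Γ] : Ctx (Γ × ℕ) where
  depth := depth Γ + 1
  val p i := if i = depth Γ then p.2 else val p.1 i
  table p := table p.1
  size p := size p.1 + p.2
  val_le p i hi := by
    split_ifs with h
    · exact Nat.le_add_left _ _
    · exact (val_le p.1 i (by omega)).trans (Nat.le_add_right _ _)
  table_le p := table_le p.1

section
variable {Γ : Type} [Ctx Γ]

/-- Polynomially bounded functions of a context. -/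
def PolyBdd (f : Γ → ℕ) : Prop := ∃ A : ℕ, ∀ γ, f γ ≤ (Ctx.size γ + 2) ^ A

namespace PolyBdd

theorem mono {f g : Γ → ℕ} (hg : PolyBdd g) (h : ∀ γ, f γ ≤ g γ) : PolyBdd f := by
  obtain ⟨A, hA⟩ := hg
  exact ⟨A, fun γ => (h γ).trans (hA γ)⟩

theorem const (c : ℕ) : PolyBdd (fun _ : Γ => c) :=
  ⟨c, fun γ => (Nat.lt_two_pow_self).le.trans (Nat.pow_le_pow_left (by omega) c)⟩

theorem size : PolyBdd (fun γ : Γ => Ctx.size γ) := ⟨1, fun γ => by simp⟩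

theorem mul {f g : Γ → ℕ} (hf : PolyBdd f) (hg : PolyBdd g) : PolyBdd (fun γ => f γ * g γ) := by
  obtain ⟨A, hA⟩ := hf
  obtain ⟨B, hB⟩ := hg
  exact ⟨A + B, fun γ => by rw [pow_add]; exact Nat.mul_le_mul (hA γ) (hB γ)⟩

theorem add {f g : Γ → ℕ} (hf : PolyBdd f) (hg : PolyBdd g) : PolyBdd (fun γ => f γ + g γ) := by
  obtain ⟨A, hA⟩ := hf
  obtain ⟨B, hB⟩ := hg
  refine ⟨max A B + 1, fun γ => ?_⟩
  have h1 := (hA γ).trans (Nat.pow_le_pow_right (by omega) (le_max_left A B))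
  have h2 := (hB γ).trans (Nat.pow_le_pow_right (by omega) (le_max_right A B))
  calc f γ + g γ ≤ (Ctx.size γ + 2) ^ max A B * 2 := by omega
    _ ≤ _ := by rw [pow_succ]; exact Nat.mul_le_mul_left _ (by omega)

theorem pow {f : Γ → ℕ} (hf : PolyBdd f) (e : ℕ) : PolyBdd (fun γ => f γ ^ e) := by
  obtain ⟨A, hA⟩ := hf
  exact ⟨A * e, fun γ => by rw [pow_mul]; exact Nat.pow_le_pow_left (hA γ) e⟩

/-- Gives one bound on the cost of a loop body that serves for all values of the loop counter. -/
theorem comp_pair {g : Γ × ℕ → ℕ} {b : Γ → ℕ} (hg : PolyBdd g) (hb : PolyBdd b) :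
    ∃ h : Γ → ℕ, PolyBdd h ∧ ∀ γ, ∀ x ≤ b γ, g (γ, x) ≤ h γ := by
  obtain ⟨A, hA⟩ := hg
  refine ⟨_, ((size.add hb).add (const 2)).pow A, fun γ x hx => (hA _).trans ?_⟩
  apply Nat.pow_le_pow_left
  change Ctx.size γ + x + 2 ≤ _
  omega

end PolyBdd

/-- The numbers of the context `γ` are held in the registers `r 0, r 1, …`, and its table in
bank `0`. -/
def Holds (r : ℕ → ℕ) (γ : Γ) (s : State) : Prop :=
  (∀ i < Ctx.depth Γ, s.reg (r i) = Ctx.val γ i) ∧ s.mem 0 = Ctx.table γ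

/-- Only registers from `D` on and the output may differ. -/
def Frame (D : ℕ) (s s' : State) : Prop := (∀ i < D, s'.reg i = s.reg i) ∧ s'.mem = s.mem

theorem Frame.trans {D E F : ℕ} {s s' s'' : State} (h : Frame D s s') (h' : Frame E s' s'')
    (hD : F ≤ D) (hE : F ≤ E) : Frame F s s'' :=
  ⟨fun i hi => (h'.1 i (by omega)).trans (h.1 i (by omega)), h'.2.trans h.2⟩

theorem Holds.frame {r : ℕ → ℕ} {γ : Γ} {s s' : State} {D : ℕ} (h : Holds r γ s)
    (hr : ∀ i < Ctx.depth Γ, r i < D) (hf : Frame D s s') : Holds r γ s' :=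
  ⟨fun i hi => (hf.1 _ (hr i hi)).trans (h.1 i hi), by rw [hf.2, h.2]⟩

/-- The register assignment of an extended context. -/
def extend (Γ : Type) [Ctx Γ] (r : ℕ → ℕ) (R : ℕ) : ℕ → ℕ := Function.update r (Ctx.depth Γ) R

theorem extend_lt {r : ℕ → ℕ} {R D : ℕ} (hr : ∀ i < Ctx.depth Γ, r i < D) (hR : R < D) :
    ∀ i < Ctx.depth (Γ × ℕ), extend Γ r R i < D := by
  intro i hi
  change i < Ctx.depth Γ + 1 at hi
  by_cases h : i = Ctx.depth Γ
  · simpa [extend, h] using hR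
  · simpa [extend, h] using hr i (by omega)

theorem Holds.extend {r : ℕ → ℕ} {γ : Γ} {s : State} {R x : ℕ} (h : Holds r γ s)
    (hx : s.reg R = x) : Holds (extend Γ r R) (γ, x) s := by
  refine ⟨fun i hi => ?_, h.2⟩
  change i < Ctx.depth Γ + 1 at hi
  change _ = if i = Ctx.depth Γ then x else Ctx.val γ i
  by_cases hi' : i = Ctx.depth Γ
  · simpa [SuccRAM.extend, hi'] using hx
  · simpa [SuccRAM.extend, hi'] using h.1 i (by omega)

/-- In a context held in the registers given by `r`, the program `P` halts in time `T`, keeps the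
memory and the registers below `D`, and its initial and final states are related by `f`. -/
def Performs (r : ℕ → ℕ) (D : ℕ) (P : Prog) (T : Γ → ℕ) (f : Γ → State → State → Prop) : Prop :=
  ∀ γ s, Holds r γ s → ∃ t s', Run P s t s' ∧ t ≤ T γ ∧ Frame D s s' ∧ f γ s s'

/-- Polynomially bounded functions computed in polynomial time, whatever registers hold the
context. -/
def Comp (f : Γ → ℕ) : Prop :=
  PolyBdd f ∧ ∀ r D, (∀ i < Ctx.depth Γ, r i < D) → ∃ P T, PolyBdd T ∧
    Performs (Γ := Γ) r D P T fun γ s s' => s'.out = s.out ∧ s'.reg D = f γ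

/-- Lists of numbers printed in polynomial time, whatever registers hold the context. -/
def Prints (f : Γ → List ℕ) : Prop :=
  ∀ r D, (∀ i < Ctx.depth Γ, r i < D) → ∃ P T, PolyBdd T ∧
    Performs (Γ := Γ) r D P T fun γ s s' => s'.out = s.out ++ f γ

/-- A counting loop: the invariant `I` is maintained by each of the `n` rounds. -/
theorem run_while_lt {x y n T : ℕ} {p : Prog} (I : ℕ → State → Prop)
    (hI : ∀ i s, I i s → s.reg x = i ∧ s.reg y = n)
    (hstep : ∀ i < n, ∀ s, I i s → ∃ t s', Run p s t s' ∧ t ≤ T ∧ I (i + 1) s')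
    (s : State) (hs : I 0 s) :
    ∃ t s', Run (.while (.lt x y) p) s t s' ∧ t ≤ n * (T + 1) + 1 ∧ I n s' := by
  suffices H : ∀ j i, i + j = n → ∀ s, I i s →
      ∃ t s', Run (.while (.lt x y) p) s t s' ∧ t ≤ j * (T + 1) + 1 ∧ I n s' from
    H n 0 (by omega) s hs
  intro j
  induction j with
  | zero =>
    intro i hi s hs
    refine ⟨1, s, .while_false ?_, by omega, by rwa [← hi]⟩
    simp only [Test.Holds, (hI i s hs).1, (hI i s hs).2]
    omega
  | succ j ih =>
    intro i hi s hs
    obtain ⟨t, s', h1, h2, h3⟩ := hstep i (by omega) s hs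
    obtain ⟨t', s'', h4, h5, h6⟩ := ih (i + 1) (by omega) s' h3
    refine ⟨_, _, .while_true ?_ h1 h4, ?_, h6⟩
    · simp only [Test.Holds, (hI i s hs).1, (hI i s hs).2]
      omega
    · rw [Nat.succ_mul]
      omega

/-! ### Closure properties of polynomial-time functions -/

namespace Comp

theorem of_eq {f g : Γ → ℕ} (hf : Comp f) (h : ∀ γ, f γ = g γ) : Comp g := by
  rwa [← funext h]

theorem const (c : ℕ) : Comp (fun _ : Γ => c) := by
  refine ⟨.const c, fun r D hr => ⟨.instr (.const D c), fun _ => 1, .const 1, fun γ s hs =>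
    ⟨_, _, .instr _ _, le_rfl, ⟨fun i hi => ?_, rfl⟩, rfl, by simp [Instr.apply]⟩⟩⟩
  simp [Instr.apply, hi.ne]

theorem val {i : ℕ} (hi : i < Ctx.depth Γ) : Comp (fun γ : Γ => Ctx.val γ i) := by
  refine ⟨PolyBdd.size.mono fun γ => Ctx.val_le γ i hi, fun r D hr => ⟨.instr (.copy D (r i)),
    fun _ => 1, .const 1, fun γ s hs =>
    ⟨_, _, .instr _ _, le_rfl, ⟨fun i hi => ?_, rfl⟩, rfl, by simp [Instr.apply, hs.1 i hi]⟩⟩⟩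
  simp [Instr.apply, hi.ne]

theorem snd : Comp (fun p : Γ × ℕ => p.2) :=
  (val (Γ := Γ × ℕ) (i := Ctx.depth Γ) (Nat.lt_succ_self _)).of_eq fun p => by
    simp [Ctx.val]

theorem _root_.SuccRAM.PolyBdd.fst {f : Γ → ℕ} (hf : PolyBdd f) :
    PolyBdd (fun p : Γ × ℕ => f p.1) := by
  obtain ⟨A, hA⟩ := hf
  refine ⟨A, fun p => (hA p.1).trans (Nat.pow_le_pow_left ?_ A)⟩
  change Ctx.size p.1 + 2 ≤ Ctx.size p.1 + p.2 + 2
  omega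

theorem _root_.SuccRAM.Holds.fst {r : ℕ → ℕ} {p : Γ × ℕ} {s : State} (h : Holds r p s) :
    Holds r p.1 s := by
  refine ⟨fun i hi => ?_, h.2⟩
  rw [h.1 i (Nat.lt_succ_of_lt hi)]
  exact if_neg hi.ne

theorem fst {f : Γ → ℕ} (hf : Comp f) : Comp (fun p : Γ × ℕ => f p.1) := by
  refine ⟨hf.1.fst, fun r D hr => ?_⟩
  obtain ⟨P, T, hT, h⟩ := hf.2 r D fun i hi => hr i (Nat.lt_succ_of_lt hi)
  exact ⟨P, fun p => T p.1, hT.fst, fun p s hs => h p.1 s hs.fst⟩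

theorem table {f : Γ → ℕ} (hf : Comp f) : Comp (fun γ => Ctx.table γ (f γ)) := by
  refine ⟨(PolyBdd.const 1).mono fun γ => Ctx.table_le γ _, fun r D hr => ?_⟩
  obtain ⟨P, T, hT, h⟩ := hf.2 r D hr
  refine ⟨.seq P (.instr (.load D 0 D)), _, hT.add (.const 1), fun γ s hs => ?_⟩
  obtain ⟨t, s', h1, h2, h3, h4, h5⟩ := h γ s hs
  refine ⟨_, _, .seq h1 (.instr _ _), by omega, ⟨fun i hi => ?_, h3.2⟩, h4, ?_⟩
  · simpa [Instr.apply, hi.ne] using h3.1 i hi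
  · simp [Instr.apply, h5, h3.2, hs.2]

theorem succ {f : Γ → ℕ} (hf : Comp f) : Comp (fun γ => f γ + 1) := by
  refine ⟨hf.1.add (.const 1), fun r D hr => ?_⟩
  obtain ⟨P, T, hT, h⟩ := hf.2 r D hr
  refine ⟨.seq P (.instr (.inc D)), _, hT.add (.const 1), fun γ s hs => ?_⟩
  obtain ⟨t, s', h1, h2, h3, h4, h5⟩ := h γ s hs
  refine ⟨_, _, .seq h1 (.instr _ _), by omega, ⟨fun i hi => ?_, h3.2⟩, h4, ?_⟩
  · simpa [Instr.apply, hi.ne] using h3.1 i hi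
  · simp [Instr.apply, h5]

/-- The second program is taken with scratch registers from `D + 1` on, so it cannot destroy the
first result in register `D`. -/
theorem pair_performs {f g : Γ → ℕ} (hf : Comp f) (hg : Comp g) (r : ℕ → ℕ) (D : ℕ)
    (hr : ∀ i < Ctx.depth Γ, r i < D) : ∃ P T, PolyBdd T ∧
      Performs (Γ := Γ) r D P T fun γ s s' =>
        s'.out = s.out ∧ s'.reg D = f γ ∧ s'.reg (D + 1) = g γ := by
  obtain ⟨P, T, hT, h⟩ := hf.2 r D hr
  obtain ⟨P', T', hT', h'⟩ := hg.2 r (D + 1) fun i hi => (hr i hi).trans (Nat.lt_succ_self D)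
  refine ⟨.seq P P', _, hT.add hT', fun γ s hs => ?_⟩
  obtain ⟨t, s', h1, h2, h3, h4, h5⟩ := h γ s hs
  obtain ⟨t', s'', k1, k2, k3, k4, k5⟩ := h' γ s' (hs.frame hr h3)
  exact ⟨_, _, .seq h1 k1, by omega, h3.trans k3 le_rfl (by omega), k4.trans h4,
    (k3.1 D (by omega)).trans h5, k5⟩

/-- Serves both computed numbers and printed lists. The conditions `hF₁`, `hF₂` say that evaluating
the test beforehand, which leaves the output alone, does not matter. -/
theorem ite_performs {f g : Γ → ℕ} (hf : Comp f) (hg : Comp g) (r : ℕ → ℕ) (D : ℕ)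
    (hr : ∀ i < Ctx.depth Γ, r i < D) {P₁ P₂ : Prog} {T₁ T₂ : Γ → ℕ} (hT₁ : PolyBdd T₁)
    (hT₂ : PolyBdd T₂) {F₁ F₂ : Γ → State → State → Prop}
    (hF₁ : ∀ γ s s' s'', s'.out = s.out → F₁ γ s' s'' → F₁ γ s s'')
    (hF₂ : ∀ γ s s' s'', s'.out = s.out → F₂ γ s' s'' → F₂ γ s s'')
    (h₁ : Performs r D P₁ T₁ F₁) (h₂ : Performs r D P₂ T₂ F₂) :
    ∃ P T, PolyBdd T ∧ Performs (Γ := Γ) r D P T fun γ s s' =>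
      if f γ < g γ then F₁ γ s s' else F₂ γ s s' := by
  obtain ⟨P, T, hT, h⟩ := pair_performs hf hg r D hr
  refine ⟨.seq P (.ite (.lt D (D + 1)) P₁ P₂), _, (hT.add (.const 1)).add (hT₁.add hT₂),
    fun γ s hs => ?_⟩
  obtain ⟨t, s', h1, h2, h3, h4, h5, h6⟩ := h γ s hs
  beta_reduce
  split_ifs with hlt
  · obtain ⟨t', s'', k1, k2, k3, k4⟩ := h₁ γ s' (hs.frame hr h3)
    exact ⟨_, _, .seq h1 (.ite_true (by simpa [Test.Holds, h5, h6] using hlt) k1), by omega,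
      h3.trans k3 le_rfl le_rfl, hF₁ _ _ _ _ h4 k4⟩
  · obtain ⟨t', s'', k1, k2, k3, k4⟩ := h₂ γ s' (hs.frame hr h3)
    exact ⟨_, _, .seq h1 (.ite_false (by simpa [Test.Holds, h5, h6] using hlt) k1), by omega,
      h3.trans k3 le_rfl le_rfl, hF₂ _ _ _ _ h4 k4⟩

theorem ite_lt {a b f g : Γ → ℕ} (ha : Comp a) (hb : Comp b) (hf : Comp f) (hg : Comp g) :
    Comp (fun γ => if a γ < b γ then f γ else g γ) := by
  refine ⟨(hf.1.add hg.1).mono fun γ => by split_ifs <;> omega, fun r D hr => ?_⟩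
  obtain ⟨P₁, T₁, hT₁, h₁⟩ := hf.2 r D hr
  obtain ⟨P₂, T₂, hT₂, h₂⟩ := hg.2 r D hr
  obtain ⟨P, T, hT, h⟩ := ite_performs ha hb r D hr hT₁ hT₂
    (fun _ _ _ _ e h => ⟨h.1.trans e, h.2⟩) (fun _ _ _ _ e h => ⟨h.1.trans e, h.2⟩) h₁ h₂
  refine ⟨P, T, hT, fun γ s hs => ?_⟩
  obtain ⟨t, s', h1, h2, h3, h4⟩ := h γ s hs
  refine ⟨t, s', h1, h2, h3, ?_⟩
  beta_reduce
  split_ifs at h4 ⊢ <;> exact h4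

/-- Recursion on a number, provided that the values stay polynomially bounded. -/
theorem nat_rec {a c B : Γ → ℕ} {g : (Γ × ℕ) × ℕ → ℕ} (F : Γ → ℕ → ℕ) (ha : Comp a)
    (hc : Comp c) (hg : Comp g) (hB : PolyBdd B) (hF0 : ∀ γ, F γ 0 = a γ)
    (hF : ∀ γ i, F γ (i + 1) = g ((γ, i), F γ i)) (hFB : ∀ γ, ∀ i ≤ c γ, F γ i ≤ B γ) :
    Comp (fun γ => F γ (c γ)) := by
  refine ⟨hB.mono fun γ => hFB γ _ le_rfl, fun r D hr => ?_⟩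
  obtain ⟨P, T, hT, h⟩ := ha.2 r D hr
  obtain ⟨P₂, T₂, hT₂, h₂⟩ := hc.2 r (D + 2) fun i hi => (hr i hi).trans (by omega)
  obtain ⟨P₃, T₃, hT₃, h₃⟩ := hg.2 (extend _ (extend Γ r (D + 1)) D) (D + 3)
    (extend_lt (extend_lt (fun i hi => (hr i hi).trans (by omega)) (by omega)) (by omega))
  obtain ⟨C₁, hC₁, hC₁'⟩ := hT₃.comp_pair hB.fst
  obtain ⟨C, hC, hC'⟩ := hC₁.comp_pair hc.1
  -- Register `D` holds the current value, `D + 1` the counter and `D + 2` the number of rounds; the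
  -- step function works from `D + 3` on.
  let body : Prog := .seq P₃ (.seq (.instr (.copy D (D + 3))) (.instr (.inc (D + 1))))
  refine ⟨.seq P (.seq P₂ (.seq (.instr (.const (D + 1) 0)) (.while (.lt (D + 1) (D + 2)) body))),
    _, (hT.add hT₂).add (((hc.1.mul ((hC.add (.const 2)).add (.const 1))).add (.const 1)).add
      (.const 1)), fun γ s hs => ?_⟩
  obtain ⟨t, s₁, h1, h2, h3, h4, h5⟩ := h γ s hs
  obtain ⟨t', s₂, k1, k2, k3, k4, k5⟩ := h₂ γ s₁ (hs.frame hr h3)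
  let I : ℕ → State → Prop := fun i u => Frame D s u ∧ u.out = s.out ∧
    u.reg D = F γ i ∧ u.reg (D + 1) = i ∧ u.reg (D + 2) = c γ
  obtain ⟨t₃, s₃, l1, l2, l3⟩ := run_while_lt (x := D + 1) (y := D + 2) (n := c γ) (T := C γ + 2)
    (p := body) I (fun i u hu => hu.2.2.2) (by
      rintro i hi u ⟨u1, u2, u3, u4, u5⟩
      obtain ⟨t, v, v1, v2, v3, v4, v5⟩ := h₃ ((γ, i), F γ i) u
        (((hs.frame hr u1).extend u4).extend u3)
      have e1 := hC₁' (γ, i) _ (hFB γ i hi.le)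
      have e2 := hC' γ i hi.le
      refine ⟨_, _, .seq v1 (.seq (.instr _ _) (.instr _ _)), by omega,
        ⟨fun j hj => ?_, ?_⟩, ?_, ?_, ?_, ?_⟩
      · have : j ≠ D + 1 := by omega
        simpa [Instr.apply, hj.ne, this] using (v3.1 j (by omega)).trans (u1.1 j hj)
      · exact v3.2.trans u1.2
      · exact v4.trans u2
      · simp [Instr.apply, v5, hF]
      · simp [Instr.apply, v3.1 (D + 1) (by omega), u4]
      · simp [Instr.apply, v3.1 (D + 2) (by omega), u5]) ((Instr.const (D + 1) 0).apply s₂) (show I 0 _ from by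
      refine ⟨⟨fun j hj => ?_, k3.2.trans h3.2⟩, k4.trans h4, ?_, ?_, ?_⟩
      · have : j ≠ D + 1 := by omega
        simpa [Instr.apply, this] using (k3.1 j (by omega)).trans (h3.1 j hj)
      · simp [Instr.apply, k3.1 D (by omega), h5, hF0]
      · simp [Instr.apply]
      · simp [Instr.apply, k5])
  exact ⟨_, _, .seq h1 (.seq k1 (.seq (.instr _ _) l1)), by omega, l3.1, l3.2.1, l3.2.2.1⟩

end Comp

/-! ### Closure properties of printed lists -/

namespace Prints

theorem of_eq {f g : Γ → List ℕ} (hf : Prints f) (h : ∀ γ, f γ = g γ) : Prints g := by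
  rwa [← funext h]

theorem nil : Prints (fun _ : Γ => []) := fun _ D _ =>
  ⟨.instr (.const D 0), fun _ => 1, .const 1, fun _ s _ =>
    ⟨_, _, .instr _ s, le_rfl, ⟨fun i hi => by simp [Instr.apply, hi.ne], rfl⟩, by
      simp [Instr.apply]⟩⟩

theorem singleton {f : Γ → ℕ} (hf : Comp f) : Prints (fun γ => [f γ]) := by
  intro r D hr
  obtain ⟨P, T, hT, h⟩ := hf.2 r D hr
  refine ⟨.seq P (.instr (.emit D)), _, hT.add (.const 1), fun γ s hs => ?_⟩
  obtain ⟨t, s', h1, h2, h3, h4, h5⟩ := h γ s hs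
  exact ⟨_, _, .seq h1 (.instr _ _), by omega, h3, by simp [Instr.apply, h4, h5]⟩

theorem append {f g : Γ → List ℕ} (hf : Prints f) (hg : Prints g) :
    Prints (fun γ => f γ ++ g γ) := by
  intro r D hr
  obtain ⟨P, T, hT, h⟩ := hf r D hr
  obtain ⟨P', T', hT', h'⟩ := hg r D hr
  refine ⟨.seq P P', _, hT.add hT', fun γ s hs => ?_⟩
  obtain ⟨t, s', h1, h2, h3, h4⟩ := h γ s hs
  obtain ⟨t', s'', k1, k2, k3, k4⟩ := h' γ s' (hs.frame hr h3)
  exact ⟨_, _, .seq h1 k1, by omega, h3.trans k3 le_rfl le_rfl, by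
    simp only [k4, h4, List.append_assoc]⟩

theorem cons {f : Γ → ℕ} {g : Γ → List ℕ} (hf : Comp f) (hg : Prints g) :
    Prints (fun γ => f γ :: g γ) := (singleton hf).append hg

theorem ite_lt {a b : Γ → ℕ} {f g : Γ → List ℕ} (ha : Comp a) (hb : Comp b) (hf : Prints f)
    (hg : Prints g) : Prints (fun γ => if a γ < b γ then f γ else g γ) := by
  intro r D hr
  obtain ⟨P₁, T₁, hT₁, h₁⟩ := hf r D hr
  obtain ⟨P₂, T₂, hT₂, h₂⟩ := hg r D hr
  obtain ⟨P, T, hT, h⟩ := Comp.ite_performs ha hb r D hr hT₁ hT₂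
    (fun _ _ _ _ e h => h.trans (by rw [e])) (fun _ _ _ _ e h => h.trans (by rw [e])) h₁ h₂
  refine ⟨P, T, hT, fun γ s hs => ?_⟩
  obtain ⟨t, s', h1, h2, h3, h4⟩ := h γ s hs
  refine ⟨t, s', h1, h2, h3, ?_⟩
  beta_reduce
  split_ifs at h4 ⊢ <;> exact h4

theorem flatMap_range {c : Γ → ℕ} {g : Γ → ℕ → List ℕ} (hc : Comp c)
    (hg : Prints (fun p : Γ × ℕ => g p.1 p.2)) :
    Prints (fun γ => (List.range (c γ)).flatMap (g γ)) := by
  intro r D hr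
  obtain ⟨P₂, T₂, hT₂, h₂⟩ := hc.2 r (D + 1) fun i hi => (hr i hi).trans (by omega)
  obtain ⟨P₃, T₃, hT₃, h₃⟩ := hg (extend Γ r D) (D + 2)
    (extend_lt (fun i hi => (hr i hi).trans (by omega)) (by omega))
  obtain ⟨C, hC, hC'⟩ := hT₃.comp_pair hc.1
  let body : Prog := .seq P₃ (.instr (.inc D))
  refine ⟨.seq P₂ (.seq (.instr (.const D 0)) (.while (.lt D (D + 1)) body)),
    _, hT₂.add (((hc.1.mul ((hC.add (.const 1)).add (.const 1))).add (.const 1)).add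
      (.const 1)), fun γ s hs => ?_⟩
  obtain ⟨t', s₂, k1, k2, k3, k4, k5⟩ := h₂ γ s hs
  let I : ℕ → State → Prop := fun i u => Frame D s u ∧
    u.out = s.out ++ (List.range i).flatMap (g γ) ∧ u.reg D = i ∧ u.reg (D + 1) = c γ
  obtain ⟨t₃, s₃, l1, l2, l3⟩ := run_while_lt (x := D) (y := D + 1) (n := c γ) (T := C γ + 1)
    (p := body) I (fun i u hu => hu.2.2) (by
      rintro i hi u ⟨u1, u2, u4, u5⟩
      obtain ⟨t, v, v1, v2, v3, v4⟩ := h₃ (γ, i) u ((hs.frame hr u1).extend u4)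
      have e2 := hC' γ i hi.le
      refine ⟨_, _, .seq v1 (.instr _ _), by omega, ⟨fun j hj => ?_, ?_⟩, ?_, ?_, ?_⟩
      · simpa [Instr.apply, hj.ne] using (v3.1 j (by omega)).trans (u1.1 j hj)
      · exact v3.2.trans u1.2
      · simp [Instr.apply, v4, u2, List.range_succ]
      · simp [Instr.apply, v3.1 D (by omega), u4]
      · simp [Instr.apply, v3.1 (D + 1) (by omega), u5]) ((Instr.const D 0).apply s₂) (show I 0 _ from by
      refine ⟨⟨fun j hj => ?_, k3.2⟩, ?_, ?_, ?_⟩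
      · simpa [Instr.apply, hj.ne] using k3.1 j (by omega)
      · simp [Instr.apply, k4]
      · simp [Instr.apply]
      · simp [Instr.apply, k5])
  exact ⟨_, _, .seq k1 (.seq (.instr _ _) l1), by omega, l3.1, l3.2.1⟩

end Prints

end

end SuccRAM

namespace SuccRAM

/-! ### Arithmetic on the machine -/

section
variable {Γ : Type} [Ctx Γ]

open Classical in
/-- Predicates decided in polynomial time. -/
def CompP (p : Γ → Prop) : Prop := Comp (fun γ => if p γ then 1 else 0)

namespace Comp

theorem ite {p : Γ → Prop} [∀ γ, Decidable (p γ)] {f g : Γ → ℕ} (hp : CompP p) (hf : Comp f)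
    (hg : Comp g) : Comp (fun γ => if p γ then f γ else g γ) :=
  (ite_lt (const 0) hp hf hg).of_eq fun γ => by by_cases h : p γ <;> simp [h]

theorem add {f g : Γ → ℕ} (hf : Comp f) (hg : Comp g) : Comp (fun γ => f γ + g γ) :=
  nat_rec (fun γ i => f γ + i) hf hg (g := fun q => q.2 + 1) snd.succ (hf.1.add hg.1)
    (fun _ => rfl) (fun _ _ => rfl) fun _ _ hi => by omega

theorem mul {f g : Γ → ℕ} (hf : Comp f) (hg : Comp g) : Comp (fun γ => f γ * g γ) :=
  nat_rec (fun γ i => f γ * i) (const 0) hg (snd.add hf.fst.fst) (hf.1.mul hg.1)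
    (fun _ => rfl) (fun _ _ => rfl) fun _ _ hi => Nat.mul_le_mul_left _ hi

theorem pow {f : Γ → ℕ} (hf : Comp f) : ∀ e : ℕ, Comp (fun γ => f γ ^ e)
  | 0 => const 1
  | e + 1 => (pow hf e).mul hf

theorem sum_range {c : Γ → ℕ} {g : Γ → ℕ → ℕ} (hc : Comp c)
    (hg : Comp (fun p : Γ × ℕ => g p.1 p.2)) :
    Comp (fun γ => ∑ i ∈ Finset.range (c γ), g γ i) := by
  obtain ⟨B, hB, hB'⟩ := hg.1.comp_pair hc.1
  refine nat_rec (fun γ i => ∑ j ∈ Finset.range i, g γ j) (const 0) hc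
    (snd.add hg.fst) (hc.1.mul hB) (fun _ => rfl) (fun γ i => ?_) fun γ i hi => ?_
  · rw [Finset.sum_range_succ, add_comm]
  · refine (Finset.sum_le_card_nsmul _ _ (B γ) fun j hj => hB' γ j ?_).trans ?_
    · exact (Finset.mem_range.1 hj).le.trans hi
    · rw [Finset.card_range]
      exact Nat.mul_le_mul_right _ hi

end Comp

namespace CompP

theorem of_iff {p q : Γ → Prop} (hp : CompP p) (h : ∀ γ, p γ ↔ q γ) : CompP q := by
  rwa [← funext fun γ => propext (h γ)]

theorem lt {f g : Γ → ℕ} (hf : Comp f) (hg : Comp g) : CompP (fun γ => f γ < g γ) :=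
  (Comp.ite_lt hf hg (.const 1) (.const 0)).of_eq fun γ => by congr

theorem not {p : Γ → Prop} (hp : CompP p) : CompP (fun γ => ¬ p γ) := by
  classical
  exact (Comp.ite hp (.const 0) (.const 1)).of_eq fun γ => by by_cases h : p γ <;> simp [h]

theorem and {p q : Γ → Prop} (hp : CompP p) (hq : CompP q) : CompP (fun γ => p γ ∧ q γ) := by
  classical
  exact (Comp.ite hp hq (.const 0)).of_eq fun γ => by by_cases h : p γ <;> simp [h]

theorem or {p q : Γ → Prop} (hp : CompP p) (hq : CompP q) : CompP (fun γ => p γ ∨ q γ) :=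
  (hp.not.and hq.not).not.of_iff fun γ => by tauto

theorem imp {p q : Γ → Prop} (hp : CompP p) (hq : CompP q) : CompP (fun γ => p γ → q γ) :=
  (hp.not.or hq).of_iff fun γ => by tauto

theorem le {f g : Γ → ℕ} (hf : Comp f) (hg : Comp g) : CompP (fun γ => f γ ≤ g γ) :=
  (lt hg hf).not.of_iff fun _ => not_lt

theorem eq {f g : Γ → ℕ} (hf : Comp f) (hg : Comp g) : CompP (fun γ => f γ = g γ) :=
  ((le hf hg).and (le hg hf)).of_iff fun _ => le_antisymm_iff.symm

theorem ne {f g : Γ → ℕ} (hf : Comp f) (hg : Comp g) : CompP (fun γ => f γ ≠ g γ) :=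
  (eq hf hg).not

theorem exists_lt {c : Γ → ℕ} {p : Γ → ℕ → Prop} (hc : Comp c)
    (hp : CompP (fun q : Γ × ℕ => p q.1 q.2)) : CompP (fun γ => ∃ i < c γ, p γ i) := by
  classical
  refine (lt (.const 0) (Comp.sum_range (g := fun γ i => if p γ i then 1 else 0) hc
    (Comp.ite hp (.const 1) (.const 0)))).of_iff fun γ => ?_
  simp [Nat.pos_iff_ne_zero]

theorem forall_lt {c : Γ → ℕ} {p : Γ → ℕ → Prop} (hc : Comp c)
    (hp : CompP (fun q : Γ × ℕ => p q.1 q.2)) : CompP (fun γ => ∀ i < c γ, p γ i) :=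
  (exists_lt (p := fun γ i => ¬ p γ i) hc hp.not).not.of_iff fun γ => by push Not; rfl

end CompP

theorem Prints.ite {p : Γ → Prop} [∀ γ, Decidable (p γ)] {f g : Γ → List ℕ} (hp : CompP p)
    (hf : Prints f) (hg : Prints g) : Prints (fun γ => if p γ then f γ else g γ) :=
  (ite_lt (.const 0) hp hf hg).of_eq fun γ => by by_cases h : p γ <;> simp [h]

namespace Comp

/-- The difference counts the `i < f γ` with `g γ ≤ i`. Division, binary length and least witness
are likewise obtained by counting. -/
theorem sub {f g : Γ → ℕ} (hf : Comp f) (hg : Comp g) : Comp (fun γ => f γ - g γ) := by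
  refine (sum_range (g := fun γ i => if g γ ≤ i then 1 else 0) hf
    (ite (CompP.le hg.fst snd) (const 1) (const 0))).of_eq fun γ => ?_
  rw [Finset.sum_boole, ← Nat.card_Ico, Nat.cast_id]
  congr 1
  ext i
  simp [and_comm]

theorem div {f g : Γ → ℕ} (hf : Comp f) (hg : Comp g) : Comp (fun γ => f γ / g γ) := by
  refine (sum_range (g := fun γ i => if 0 < g γ ∧ (i + 1) * g γ ≤ f γ then 1 else 0) hf
    (ite ((CompP.lt (const 0) hg.fst).and (CompP.le (snd.succ.mul hg.fst) hf.fst))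
      (const 1) (const 0))).of_eq fun γ => ?_
  rw [Finset.sum_boole, Nat.cast_id, ← Finset.card_range (f γ / g γ)]
  congr 1
  ext i
  rcases Nat.eq_zero_or_pos (g γ) with h | h
  · simp [h]
  · simp only [Finset.mem_filter, Finset.mem_range, h, true_and, ← Nat.le_div_iff_mul_le h]
    have := Nat.div_le_self (f γ) (g γ)
    omega

theorem mod {f g : Γ → ℕ} (hf : Comp f) (hg : Comp g) : Comp (fun γ => f γ % g γ) :=
  (hf.sub (hg.mul (hf.div hg))).of_eq fun _ => Nat.mod_eq_sub_mul_div.symm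

/-- A power of two with a computed exponent need not be polynomially bounded; capping it at every
doubling keeps the recursion bounded. -/
theorem min_two_pow {b e : Γ → ℕ} (hb : Comp b) (he : Comp e) :
    Comp (fun γ => min (b γ) (2 ^ e γ)) := by
  have hmin : ∀ {Δ : Type} [Ctx Δ] {f g : Δ → ℕ}, Comp f → Comp g →
      Comp (fun γ => min (f γ) (g γ)) := fun hf hg =>
    (ite (CompP.le hf hg) hf hg).of_eq fun γ => by rw [min_def]
  refine nat_rec (fun γ i => min (b γ) (2 ^ i)) (hmin hb (const 1)) he
    (hmin hb.fst.fst ((const 2).mul snd)) hb.1 (fun _ => rfl) (fun γ i => ?_)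
    fun γ i _ => min_le_left _ _
  simp only [pow_succ]
  omega

theorem testBit {x j : Γ → ℕ} (hx : Comp x) (hj : Comp j) :
    Comp (fun γ => ((x γ).testBit (j γ)).toNat) := by
  -- Capping the divisor at `x γ + 1` does not change the quotient: if the cap is active, both
  -- quotients are zero.
  refine ((hx.div (min_two_pow hx.succ hj)).mod (const 2)).of_eq fun γ => ?_
  rw [Nat.toNat_testBit]
  congr 1
  rcases le_total (x γ + 1) (2 ^ j γ) with h | h
  · rw [min_eq_left h, Nat.div_eq_of_lt (by omega), Nat.div_eq_of_lt (by omega)]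
  · rw [min_eq_right h]

theorem size {f : Γ → ℕ} (hf : Comp f) : Comp (fun γ => (f γ).size) := by
  refine (sum_range (g := fun γ i => if min (f γ + 1) (2 ^ i) ≤ f γ then 1 else 0) hf
    (ite (CompP.le (min_two_pow hf.fst.succ snd) hf.fst)
      (const 1) (const 0))).of_eq fun γ => ?_
  rw [Finset.sum_boole, Nat.cast_id, ← Finset.card_range (Nat.size _)]
  congr 1
  ext i
  have h1 : (f γ).size ≤ f γ := Nat.size_le.2 Nat.lt_two_pow_self
  have h2 : i < (f γ).size ↔ 2 ^ i ≤ f γ := Nat.lt_size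
  simp only [Finset.mem_filter, Finset.mem_range]
  omega

theorem two_pow_size {f : Γ → ℕ} (hf : Comp f) : Comp (fun γ => 2 ^ (f γ).size) := by
  refine (min_two_pow ((const 2).mul hf).succ hf.size).of_eq fun γ => ?_
  apply min_eq_right
  rcases h : (f γ).size with _ | i
  · simp
  · have : 2 ^ i ≤ f γ := Nat.lt_size.1 (by omega)
    rw [pow_succ]
    omega

end Comp

/-- The least number below `b` that satisfies `p`, and `b` if there is none. -/
noncomputable def least (b : ℕ) (p : ℕ → Prop) : ℕ := sInf ({i | p i} ∪ {b})

theorem least_spec {b : ℕ} {p : ℕ → Prop} (h : ∃ i < b, p i) : p (least b p) := by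
  obtain ⟨i, hi, hp⟩ := h
  rcases Nat.sInf_mem (s := {i | p i} ∪ {b}) ⟨b, Or.inr rfl⟩ with h | h
  · exact h
  · have : sInf ({i | p i} ∪ {b}) ≤ i := Nat.sInf_le (Or.inl hp)
    rw [Set.mem_singleton_iff] at h
    omega

/-- Lets a predicate be evaluated at an inner loop variable while ignoring the outer one: the same
program runs with a register assignment that skips the outer counter. -/
theorem Comp.drop_middle {f : Γ × ℕ → ℕ} (hf : Comp f) :
    Comp (fun q : (Γ × ℕ) × ℕ => f (q.1.1, q.2)) := by
  constructor
  · obtain ⟨A, hA⟩ := hf.1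
    refine ⟨A, fun q => (hA _).trans (Nat.pow_le_pow_left ?_ A)⟩
    change Ctx.size q.1.1 + q.2 + 2 ≤ Ctx.size q.1.1 + q.1.2 + q.2 + 2
    omega
  intro r D hr
  have hr' : ∀ i < Ctx.depth Γ + 2, r i < D := hr
  obtain ⟨P, T, hT, h⟩ := hf.2 (extend Γ r (r (Ctx.depth Γ + 1))) D
    (extend_lt (fun i hi => hr' i (by omega)) (hr' _ (by omega)))
  refine ⟨P, fun q => T (q.1.1, q.2), ?_, fun q s hs => h (q.1.1, q.2) s (hs.fst.fst.extend ?_)⟩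
  · obtain ⟨A, hA⟩ := hT
    refine ⟨A, fun q => (hA _).trans (Nat.pow_le_pow_left ?_ A)⟩
    change Ctx.size q.1.1 + q.2 + 2 ≤ Ctx.size q.1.1 + q.1.2 + q.2 + 2
    omega
  · exact (hs.1 (Ctx.depth Γ + 1) (Nat.lt_succ_self _)).trans (if_pos rfl)

theorem Comp.least {c : Γ → ℕ} {p : Γ → ℕ → Prop} (hc : Comp c)
    (hp : CompP (fun q : Γ × ℕ => p q.1 q.2)) : Comp (fun γ => least (c γ) (p γ)) := by
  classical
  have hp' : CompP (fun q : (Γ × ℕ) × ℕ => p q.1.1 q.2) := drop_middle hp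
  -- The least witness is the number of `i` up to which no witness has occurred.
  refine (sum_range (g := fun γ i => if ∀ j < i + 1, ¬ p γ j then 1 else 0) hc
    (ite (CompP.forall_lt snd.succ hp'.not) (const 1) (const 0))).of_eq fun γ => ?_
  rw [Finset.sum_boole, Nat.cast_id, ← Finset.card_range (SuccRAM.least _ _)]
  congr 1
  ext i
  simp only [Finset.mem_filter, Finset.mem_range]
  have hmem := Nat.sInf_mem (s := {i | p γ i} ∪ {c γ}) ⟨c γ, Or.inr rfl⟩
  have hle : SuccRAM.least (c γ) (p γ) ≤ c γ := Nat.sInf_le (Or.inr rfl)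
  constructor
  · rintro ⟨h1, h2⟩
    by_contra h3
    rcases hmem with h | h
    · exact h2 _ (by unfold SuccRAM.least at h3; omega) h
    · unfold SuccRAM.least at h3
      rw [Set.mem_singleton_iff] at h
      omega
  · refine fun h => ⟨by omega, fun j hj hpj => ?_⟩
    have : SuccRAM.least (c γ) (p γ) ≤ j := Nat.sInf_le (Or.inl hpj)
    omega

end

end SuccRAM

namespace CliqueReduction

open scoped Finset

/-! ### A code with large distance, found by exhaustive search -/

/-- The Hamming distance of the first `l` letters. -/
def ham (l : ℕ) (f g : ℕ → Bool) : ℕ := #{j ∈ Finset.range l | f j ≠ g j}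

/-- The affine hash function with seed `s`, which packs a modulus, a slope and an intercept that
are all less than `N`. -/
def hash (N s a : ℕ) : ℕ := (s / N % N * a + s / N / N) % (s % N)

/-- The hash values of the numbers below `n` have pairwise distance at least `m` as strings of
length `8 * m`. -/
def GoodSeed (n m N s : ℕ) : Prop :=
  ∀ a < n, ∀ b < n, a ≠ b → m ≤ ham (8 * m) (hash N s a).testBit (hash N s b).testBit

/-- Give each letter `true` weight 1 and each `false` weight 3, multiplicatively. All strings
together weigh `(1 + 3) ^ (8 * m)`, and a string with fewer than `m` ones weighs at least `3 ^ (7 *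
m)`. -/
theorem card_light_mul_le (m : ℕ) :
    #{f : Fin (8 * m) → Bool | #{j | f j = true} < m} * 3 ^ (7 * m) ≤ 4 ^ (8 * m) := by
  have h : ∑ f : Fin (8 * m) → Bool, ∏ j, (if f j = true then 1 else 3) = 4 ^ (8 * m) := by
    rw [← Fintype.piFinset_univ, ← Finset.prod_univ_sum (fun _ => Finset.univ)
      (fun _ b => if b = true then 1 else 3)]
    simp
  rw [← h, ← smul_eq_mul]
  refine (Finset.card_nsmul_le_sum _ _ _ fun f hf => ?_).trans
    (Finset.sum_le_sum_of_subset (Finset.filter_subset _ _))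
  rw [Finset.prod_ite, Finset.prod_const_one, one_mul, Finset.prod_const]
  apply Nat.pow_le_pow_right (by norm_num)
  have h1 := Finset.card_filter_add_card_filter_not (s := Finset.univ) (fun j => f j = true)
  rw [Finset.card_univ, Fintype.card_fin] at h1
  have := (Finset.mem_filter.1 hf).2
  omega

/-- Adding the bits of `u` modulo 2 turns words near `u` into light words, injectively because
residues have no bits beyond `8 * m`. -/
theorem card_near_le {m p : ℕ} [NeZero p] (hp : p ≤ 2 ^ (8 * m)) (u : ℕ) :
    #{v : ZMod p | ham (8 * m) u.testBit v.val.testBit < m} ≤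
      #{f : Fin (8 * m) → Bool | #{j | f j = true} < m} := by
  refine Finset.card_le_card_of_injOn (fun v j => xor (u.testBit j) (v.val.testBit j))
    (fun v hv => ?_) fun v _ w _ h => ?_
  · simp only [Finset.coe_filter, Finset.mem_univ, true_and, Set.mem_ofPred_eq] at hv ⊢
    convert hv using 1
    unfold ham
    rw [Finset.card_filter, Finset.card_filter, Finset.sum_range]
    simp
  · apply ZMod.val_injective
    apply Nat.eq_of_testBit_eq
    intro j
    by_cases hj : j < 8 * m
    · simpa using congrFun h ⟨j, hj⟩
    · have h1 : ∀ v : ZMod p, v.val < 2 ^ j := fun v =>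
        (v.val_lt.trans_le hp).trans_le (Nat.pow_le_pow_right (by norm_num) (by omega))
      rw [Nat.testBit_lt_two_pow (h1 v), Nat.testBit_lt_two_pow (h1 w)]

/-- Bertrand's postulate gives a prime `p` between `N / 2` and `N`. For `a ≠ b`, the pair of hash
values determines slope and intercept, so at most `p * V` of the `p * p` choices are bad for `a`,
`b`; the union bound needs `n * n * V < p`. -/
theorem exists_goodSeed {n m : ℕ} (hm : 0 < m) (hn : 2 * n < 2 ^ m) :
    ∃ s < (2 ^ (8 * m)) ^ 3, GoodSeed n m (2 ^ (8 * m)) s := by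
  set N := 2 ^ (8 * m) with hN
  obtain ⟨p, hp, hp1, hp2⟩ := Nat.exists_prime_lt_and_le_two_mul (2 ^ (8 * m - 1)) (by positivity)
  have hN2 : 2 * 2 ^ (8 * m - 1) = N := by
    rw [← pow_succ', hN]
    congr 1
    omega
  have hpN : p < N := by
    refine lt_of_le_of_ne (hN2 ▸ hp2) fun h => ?_
    rw [h, hN] at hp
    exact Nat.Prime.not_prime_pow (by omega) hp
  have hnp : n < p := by
    have : 2 ^ m ≤ N := Nat.pow_le_pow_right (by norm_num) (by omega)
    omega
  have : Fact p.Prime := ⟨hp⟩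
  set V := #{f : Fin (8 * m) → Bool | #{j | f j = true} < m} with hV
  let bad : ℕ × ℕ → Finset (ZMod p × ZMod p) := fun q =>
    {c | ham (8 * m) (c.1 * q.1 + c.2).val.testBit (c.1 * q.2 + c.2).val.testBit < m}
  have hbad : ∀ q ∈ (Finset.range n).offDiag, #(bad q) ≤ p * V := by
    rintro ⟨a, b⟩ hq
    simp only [Finset.mem_offDiag, Finset.mem_range] at hq
    have hab : (a : ZMod p) - b ≠ 0 := by
      rw [sub_ne_zero]
      intro h
      rw [ZMod.natCast_eq_natCast_iff, Nat.ModEq, Nat.mod_eq_of_lt (by omega),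
        Nat.mod_eq_of_lt (by omega)] at h
      exact hq.2.2 h
    calc #(bad (a, b)) ≤ #(Finset.univ.sigma fun u : ZMod p =>
          ({v | ham (8 * m) u.val.testBit v.val.testBit < m} : Finset (ZMod p))) := by
          refine Finset.card_le_card_of_injOn (fun c => ⟨c.1 * a + c.2, c.1 * b + c.2⟩)
            (fun c hc => by simpa [bad] using hc) ?_
          rintro ⟨x, y⟩ - ⟨x', y'⟩ - h
          simp only [Sigma.mk.injEq, heq_eq_eq] at h
          have hx : x = x' := by
            have : (x - x') * ((a : ZMod p) - b) = 0 := by linear_combination h.1 - h.2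
            simpa [hab, sub_eq_zero] using this
          subst hx
          simpa using h.1
      _ ≤ p * V := by
          rw [Finset.card_sigma]
          refine (Finset.sum_le_card_nsmul _ _ V fun u _ => card_near_le hpN.le _).trans ?_
          simp [ZMod.card]
  have hunion : #((Finset.range n).offDiag.biUnion bad) <
      #(Finset.univ : Finset (ZMod p × ZMod p)) := by
    refine (Finset.card_biUnion_le_card_mul _ _ _ hbad).trans_lt ?_
    rw [Finset.card_univ, Fintype.card_prod, ZMod.card, Finset.offDiag_card, Finset.card_range]
    have h1 : n * n * V < p := by
      by_contra! h
      have h2 : V * 2187 ^ m ≤ 65536 ^ m := by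
        have := card_light_mul_le m
        rwa [pow_mul, pow_mul] at this
      have h3 : (2 * n) * (2 * n) ≤ 4 ^ m := by
        calc (2 * n) * (2 * n) ≤ 2 ^ m * 2 ^ m := Nat.mul_le_mul hn.le hn.le
          _ = 4 ^ m := by rw [← mul_pow]; norm_num
      have h4 : N = 256 ^ m := by rw [hN, pow_mul]; norm_num
      -- The contradiction is numerical: `256 * 2187 > 4 * 65536`. The code length `8 * m` leaves
      -- enough room for this.
      have h5 : 256 ^ m * 2187 ^ m < 4 ^ m * 65536 ^ m := by
        calc 256 ^ m * 2187 ^ m < (2 * (2 * (n * n * V))) * 2187 ^ m :=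
              Nat.mul_lt_mul_of_pos_right (by omega) (by positivity)
          _ = (2 * n) * (2 * n) * (V * 2187 ^ m) := by ring
          _ ≤ _ := Nat.mul_le_mul h3 h2
      rw [← mul_pow, ← mul_pow] at h5
      exact absurd h5 (not_lt.2 (Nat.pow_le_pow_left (by norm_num) m))
    calc (n * n - n) * (p * V) ≤ n * n * (p * V) := Nat.mul_le_mul_right _ (Nat.sub_le _ _)
      _ = p * (n * n * V) := by ring
      _ < p * p := Nat.mul_lt_mul_of_pos_left h1 hp.pos
  obtain ⟨⟨x, y⟩, -, hxy⟩ := Finset.exists_mem_notMem_of_card_lt_card hunion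
  have hx : x.val < N := x.val_lt.trans hpN
  have hy : y.val < N := y.val_lt.trans hpN
  -- The base-`N` digits of the seed are the modulus, the slope and the intercept.
  refine ⟨p + N * (x.val + N * y.val), ?_, fun a ha b hb hab => ?_⟩
  · have h1 : x.val + N * y.val < N * N := by nlinarith
    nlinarith
  · have hhash : ∀ c : ℕ, hash N (p + N * (x.val + N * y.val)) c = (x * c + y).val := by
      intro c
      unfold hash
      have hN0 : 0 < N := by positivity
      rw [Nat.add_mul_mod_self_left, Nat.add_mul_div_left _ _ hN0, Nat.mod_eq_of_lt hpN,
        Nat.div_eq_of_lt hpN, zero_add, Nat.add_mul_mod_self_left, Nat.add_mul_div_left _ _ hN0,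
        Nat.mod_eq_of_lt hx, Nat.div_eq_of_lt hx, zero_add, ← ZMod.val_natCast]
      simp
    rw [hhash, hhash]
    by_contra! h
    refine hxy (Finset.mem_biUnion.2 ⟨(a, b), ?_, ?_⟩)
    · simp [ha, hb, hab]
    · simpa [bad] using h

end CliqueReduction

namespace CliqueReduction

open scoped Finset

/-! ### Distances of blocks -/

theorem ham_comm (l : ℕ) (f g : ℕ → Bool) : ham l f g = ham l g f := by
  simp only [ham, ne_comm]

theorem ham_triangle (l : ℕ) (f g h : ℕ → Bool) : ham l f h ≤ ham l f g + ham l g h := by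
  unfold ham
  refine (Finset.card_le_card fun j hj => ?_).trans (Finset.card_union_le _ _)
  simp only [Finset.mem_union, Finset.mem_filter] at hj ⊢
  by_cases h1 : f j = g j
  · exact Or.inr ⟨hj.1, h1 ▸ hj.2⟩
  · exact Or.inl ⟨hj.1, h1⟩

theorem ham_congr {l : ℕ} {f f' g g' : ℕ → Bool} (hf : ∀ j < l, f j = f' j)
    (hg : ∀ j < l, g j = g' j) : ham l f g = ham l f' g' := by
  unfold ham
  congr 1
  refine Finset.filter_congr fun j hj => ?_
  rw [hf j (Finset.mem_range.1 hj), hg j (Finset.mem_range.1 hj)]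

theorem ham_self (l : ℕ) (f : ℕ → Bool) : ham l f f = 0 := by simp [ham]

theorem ham_eq_sum (l : ℕ) (f g : ℕ → Bool) :
    ham l f g = ∑ j ∈ Finset.range l, if f j ≠ g j then 1 else 0 := Finset.card_filter _ _

theorem ham_add_ham_not (l : ℕ) (f g : ℕ → Bool) : ham l f g + ham l f (fun j => !g j) = l := by
  rw [ham_eq_sum, ham_eq_sum, ← Finset.sum_add_distrib]
  refine (Finset.sum_congr rfl fun j _ => (?_ : _ = 1)).trans (by simp)
  cases f j <;> cases g j <;> simp

theorem ham_add (l l' : ℕ) (f g : ℕ → Bool) :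
    ham (l + l') f g = ham l f g + ham l' (fun j => f (l + j)) (fun j => g (l + j)) := by
  simp only [ham_eq_sum, Finset.sum_range_add]

theorem ham_blocks (k l : ℕ) (f g : ℕ → Bool) : ham (k * l) f g =
    ∑ i ∈ Finset.range k, ham l (fun j => f (i * l + j)) (fun j => g (i * l + j)) := by
  induction k with
  | zero => simp [ham]
  | succ k ih => rw [Nat.succ_mul, ham_add, ih, Finset.sum_range_succ]

/-- The code: a hash value of `l` bits followed by its complement. -/
def code (l N s a j : ℕ) : Bool :=
  if j < l then (hash N s a).testBit j else !(hash N s a).testBit (j - l)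

/-- A word followed by its complement has as many ones as zeros. -/
theorem ham_code_const (l N s a : ℕ) (b : Bool) : ham (2 * l) (code l N s a) (fun _ => b) = l := by
  have h1 : ham l (code l N s a) (fun _ => b) = ham l (fun _ => b) (hash N s a).testBit := by
    rw [ham_comm]
    exact ham_congr (fun _ _ => rfl) fun j hj => by simp [code, hj]
  have h2 : ham l (fun j => code l N s a (l + j)) (fun _ => b) =
      ham l (fun _ => b) fun j => !(hash N s a).testBit j := by
    rw [ham_comm]
    exact ham_congr (fun _ _ => rfl) fun j _ => by simp [code]
  rw [two_mul, ham_add, h1, h2, ham_add_ham_not]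

theorem ham_code (l N s a b : ℕ) : ham (2 * l) (code l N s a) (code l N s b) =
    2 * ham l (hash N s a).testBit (hash N s b).testBit := by
  rw [two_mul, ham_add, two_mul]
  congr 1
  · exact ham_congr (fun j hj => by simp [code, hj]) (fun j hj => by simp [code, hj])
  · simp [ham, code]

/-! ### The reduction -/

/-- The strings of the reduction, arranged in blocks. -/
def letter (i j x y b r q : ℕ) : Bool :=
  if r = i then !x.testBit q else if r = j then !y.testBit q else b.testBit 0

/-- The words `x` and `y` are not both close to the code words of two adjacent vertices. -/
def Incompatible (A : ℕ → ℕ → Prop) (n m : ℕ) (c : ℕ → ℕ → Bool) (x y : ℕ) : Prop :=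
  ∀ u < n, ∀ v < n, A u v →
    m ≤ ham (16 * m) x.testBit (c u) + ham (16 * m) y.testBit (c v)

open Classical in
/-- The strings constructed from a graph with adjacency relation `A` on `n` vertices. -/
noncomputable def strings (A : ℕ → ℕ → Prop) (n k m : ℕ) (c : ℕ → ℕ → Bool) :
    List (Fin (k * (16 * m)) → Bool) :=
  (List.range k).flatMap fun i => (List.range k).flatMap fun j =>
    (List.range (2 ^ (16 * m))).flatMap fun x => (List.range (2 ^ (16 * m))).flatMap fun y =>
      if (i < j ∨ n = 0) ∧ Incompatible A n m c x y then
        (List.range 2).map fun b t => letter i j x y b (t / (16 * m)) (t % (16 * m))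
      else []

/-- The Closest String instance constructed from a graph with adjacency relation `A` on `n`
vertices. -/
noncomputable def closestString (A : ℕ → ℕ → Prop) (n k m : ℕ) (c : ℕ → ℕ → Bool) :
    ClosestStringInstance where
  len := k * (16 * m)
  dist := if n = 0 then 0 else 8 * m * k + 15 * m
  strings := strings A n k m c

theorem mem_strings {A : ℕ → ℕ → Prop} {n k m : ℕ} {c : ℕ → ℕ → Bool}
    {z : Fin (k * (16 * m)) → Bool} : z ∈ strings A n k m c ↔
      ∃ i < k, ∃ j < k, ∃ x < 2 ^ (16 * m), ∃ y < 2 ^ (16 * m), (i < j ∨ n = 0) ∧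
        Incompatible A n m c x y ∧ ∃ b < 2,
          z = fun t : Fin (k * (16 * m)) => letter i j x y b (t / (16 * m)) (t % (16 * m)) := by
  unfold strings
  simp only [List.mem_flatMap, List.mem_range]
  constructor
  · rintro ⟨i, hi, j, hj, x, hx, y, hy, h⟩
    split_ifs at h with hc
    · obtain ⟨b, hb, rfl⟩ := List.mem_map.1 h
      exact ⟨i, hi, j, hj, x, hx, y, hy, hc.1, hc.2, b, List.mem_range.1 hb, rfl⟩
    · simp at h
  · rintro ⟨i, hi, j, hj, x, hx, y, hy, h1, h2, b, hb, rfl⟩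
    refine ⟨i, hi, j, hj, x, hx, y, hy, ?_⟩
    rw [if_pos ⟨h1, h2⟩]
    exact List.mem_map.2 ⟨b, List.mem_range.2 hb, rfl⟩

/-- The letters of block `i` of a string. -/
def block {k l : ℕ} (w : Fin (k * l) → Bool) (i q : ℕ) : Bool :=
  if h : i * l + q < k * l then w ⟨i * l + q, h⟩ else false

theorem hammingDist_eq_sum {k l : ℕ} (w : Fin (k * l) → Bool) (f : ℕ → ℕ → Bool) :
    hammingDist w (fun t => f (t / l) (t % l)) =
      ∑ i ∈ Finset.range k, ham l (block w i) (f i) := by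
  let w' : ℕ → Bool := fun t => if h : t < k * l then w ⟨t, h⟩ else false
  have h1 : hammingDist w (fun t => f (t / l) (t % l)) =
      ham (k * l) w' (fun t => f (t / l) (t % l)) := by
    rw [hammingDist, ham_eq_sum, Finset.card_filter, Finset.sum_range]
    simp [w']
  rw [h1, ham_blocks]
  refine Finset.sum_congr rfl fun i _ => ham_congr (fun j _ => rfl) fun j hj => ?_
  have hl : 0 < l := by omega
  rw [Nat.mul_comm, Nat.mul_add_div hl, Nat.div_eq_of_lt hj, Nat.mul_add_mod, Nat.mod_eq_of_lt hj,
    add_zero]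

theorem block_mk {k l : ℕ} (f : ℕ → ℕ → Bool) {i q : ℕ} (hi : i < k) (hq : q < l) :
    block (k := k) (l := l) (fun t => f (t / l) (t % l)) i q = f i q := by
  have h : i * l + q < k * l := by nlinarith
  have hl : 0 < l := by omega
  simp only [block, h, dif_pos]
  rw [Nat.mul_comm, Nat.mul_add_div hl, Nat.div_eq_of_lt hq, Nat.mul_add_mod, Nat.mod_eq_of_lt hq,
    add_zero]

theorem exists_testBit_eq (l : ℕ) (f : ℕ → Bool) : ∃ x < 2 ^ l, ∀ j < l, x.testBit j = f j :=
  ⟨Nat.ofBits fun j : Fin l => f j, Nat.ofBits_lt_two_pow _, fun j hj => by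
    rw [Nat.testBit_ofBits_lt _ _ hj]⟩

theorem sum_range_eq_of_ne {k i j : ℕ} (hi : i < k) (hj : j < k) (hij : i ≠ j) (f : ℕ → ℕ) :
    ∑ r ∈ Finset.range k, f r =
      f i + f j + ∑ r ∈ (Finset.range k).filter (fun r => r ≠ i ∧ r ≠ j), f r := by
  rw [← Finset.sum_filter_add_sum_filter_not (Finset.range k) (fun r => r ≠ i ∧ r ≠ j), add_comm]
  congr 1
  rw [← Finset.sum_pair hij]
  congr 1
  ext r
  simp only [Finset.mem_filter, Finset.mem_range, Finset.mem_insert, Finset.mem_singleton]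
  constructor
  · rintro ⟨-, h⟩
    tauto
  · rintro (rfl | rfl) <;> simp [hi, hj]

theorem card_others {k i j : ℕ} (hi : i < k) (hj : j < k) (hij : i ≠ j) :
    #{r ∈ Finset.range k | r ≠ i ∧ r ≠ j} + 2 = k := by
  have h := sum_range_eq_of_ne hi hj hij fun _ => 1
  simp only [Finset.sum_const, Finset.card_range, smul_eq_mul, mul_one] at h
  omega

/-- The distances to a string of the reduction, block by block. -/
theorem sum_ham_letter {k i j : ℕ} (hi : i < k) (hj : j < k) (hij : i ≠ j) (l x y b : ℕ)
    (f : ℕ → ℕ → Bool) : ∑ r ∈ Finset.range k, ham l (f r) (letter i j x y b r) +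
      (ham l (f i) x.testBit + ham l (f j) y.testBit) = 2 * l +
      ∑ r ∈ (Finset.range k).filter (fun r => r ≠ i ∧ r ≠ j), ham l (f r) fun _ => b.testBit 0 := by
  rw [sum_range_eq_of_ne hi hj hij]
  have h1 : letter i j x y b i = fun q => !x.testBit q := by ext; simp [letter]
  have h2 : letter i j x y b j = fun q => !y.testBit q := by ext; simp [letter, hij.symm]
  have h3 := ham_add_ham_not l (f i) x.testBit
  have h4 := ham_add_ham_not l (f j) y.testBit
  have h5 : ∑ r ∈ (Finset.range k).filter (fun r => r ≠ i ∧ r ≠ j),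
      ham l (f r) (letter i j x y b r) = ∑ r ∈ (Finset.range k).filter (fun r => r ≠ i ∧ r ≠ j),
      ham l (f r) fun _ => b.testBit 0 := by
    refine Finset.sum_congr rfl fun r hr => ?_
    congr 1
    ext q
    have := (Finset.mem_filter.1 hr).2
    simp [letter, this.1, this.2]
  rw [h1, h2, h5]
  omega

/-! ### Completeness and soundness of the reduction -/

section
variable {A : ℕ → ℕ → Prop} {n k m : ℕ} {c : ℕ → ℕ → Bool}

/-- Incompatibility, applied to the edge between `v i` and `v j`, saves `m` of the `32 * m` letters
in the two special blocks; this is why the target has `15 * m` and not `16 * m`. -/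
theorem exists_close (hc : ∀ a b, ham (16 * m) (c a) (fun _ => b) = 8 * m) {v : ℕ → ℕ}
    (hv : ∀ i < k, v i < n) (hA : ∀ i < k, ∀ j < k, i < j → A (v i) (v j)) :
    ∃ w : Fin (closestString A n k m c).len → Bool, ∀ z ∈ (closestString A n k m c).strings,
      hammingDist w z ≤ (closestString A n k m c).dist := by
  refine ⟨fun t => c (v (t / (16 * m))) (t % (16 * m)), fun z hz => ?_⟩
  obtain ⟨i, hi, j, hj, x, -, y, -, hij, hxy, b, -, rfl⟩ := mem_strings.1 hz
  have hn : n ≠ 0 := by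
    have := hv i hi
    omega
  replace hij : i < j := by tauto
  have hd : (closestString A n k m c).dist = 8 * m * k + 15 * m := if_neg hn
  rw [hd]
  refine (hammingDist_eq_sum (k := k) (l := 16 * m) _ (letter i j x y b)).trans_le ?_
  have h1 : ∑ r ∈ Finset.range k, ham (16 * m) (block (k := k) (l := 16 * m)
      (fun t => c (v (t / (16 * m))) (t % (16 * m))) r) (letter i j x y b r) =
      ∑ r ∈ Finset.range k, ham (16 * m) (c (v r)) (letter i j x y b r) :=
    Finset.sum_congr rfl fun r hr => ham_congr
      (fun q hq => block_mk (fun r q => c (v r) q) (Finset.mem_range.1 hr) hq) fun _ _ => rfl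
  refine le_of_eq_of_le h1 ?_
  have h2 := sum_ham_letter hi hj hij.ne (16 * m) x y b fun r => c (v r)
  simp only [hc, Finset.sum_const, smul_eq_mul] at h2
  have h3 := hxy _ (hv i hi) _ (hv j hj) (hA i hi j hj hij)
  rw [ham_comm _ x.testBit, ham_comm _ y.testBit] at h3
  have h4 : 8 * m * k = #{r ∈ Finset.range k | r ≠ i ∧ r ≠ j} * (8 * m) + 16 * m := by
    conv_lhs => rw [← card_others hi hj hij.ne]
    ring
  omega

/-- Both special blocks are complements of those of `w`. On the other blocks the distances to the
two constants add up to the full length, so one choice of `b` reaches the average. -/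
theorem exists_far_of_incompatible (w : Fin (k * (16 * m)) → Bool) {i j x y : ℕ}
    (hi : i < k) (hj : j < k) (hij : i < j) (hx : x < 2 ^ (16 * m)) (hy : y < 2 ^ (16 * m))
    (hxw : ∀ q < 16 * m, x.testBit q = block w i q)
    (hyw : ∀ q < 16 * m, y.testBit q = block w j q) (hxy : Incompatible A n m c x y) :
    ∃ z ∈ (closestString A n k m c).strings,
      8 * m * k + 16 * m ≤ hammingDist (β := fun _ => Bool) w z := by
  have h (b : ℕ) : hammingDist w (fun t => letter i j x y b (t / (16 * m)) (t % (16 * m))) =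
      32 * m + ∑ r ∈ (Finset.range k).filter (fun r => r ≠ i ∧ r ≠ j),
        ham (16 * m) (block w r) fun _ => b.testBit 0 := by
    have h1 := sum_ham_letter hi hj hij.ne (16 * m) x y b (block w)
    have h2 : ham (16 * m) (block w i) x.testBit = 0 := by
      rw [ham_congr (fun _ _ => rfl) hxw, ham_self]
    have h3 : ham (16 * m) (block w j) y.testBit = 0 := by
      rw [ham_congr (fun _ _ => rfl) hyw, ham_self]
    rw [hammingDist_eq_sum w (letter i j x y b)]
    omega
  have hsum : ∑ r ∈ (Finset.range k).filter (fun r => r ≠ i ∧ r ≠ j),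
        ham (16 * m) (block w r) (fun _ => Nat.testBit 0 0) +
      ∑ r ∈ (Finset.range k).filter (fun r => r ≠ i ∧ r ≠ j),
        ham (16 * m) (block w r) (fun _ => Nat.testBit 1 0) =
      #{r ∈ Finset.range k | r ≠ i ∧ r ≠ j} * (16 * m) := by
    rw [← Finset.sum_add_distrib]
    exact (Finset.sum_congr rfl fun r _ => ham_add_ham_not _ _ fun _ => Nat.testBit 0 0).trans
      (by simp)
  have h4 : 8 * m * k * 2 = #{r ∈ Finset.range k | r ≠ i ∧ r ≠ j} * (16 * m) + 32 * m := by
    conv_lhs => rw [← card_others hi hj hij.ne]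
    ring
  have hmem (b : ℕ) (hb : b < 2) :
      (fun t : Fin (k * (16 * m)) => letter i j x y b (t / (16 * m)) (t % (16 * m))) ∈
        (closestString A n k m c).strings :=
    mem_strings.2 ⟨i, hi, j, hj, x, hx, y, hy, Or.inl hij, hxy, b, hb, rfl⟩
  by_cases h0 : 8 * m * k + 16 * m ≤
      hammingDist w (fun t => letter i j x y 0 (t / (16 * m)) (t % (16 * m)))
  · exact ⟨_, hmem 0 (by omega), h0⟩
  · refine ⟨_, hmem 1 (by omega), ?_⟩
    have e0 := h 0
    have e1 := h 1
    omega

/-- Without vertices every pair of words is vacuously incompatible. The strings with `i = j`,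
allowed only in this case, make the target distance 0 unattainable even for `k = 1`. -/
theorem exists_far_of_eq_zero (hm : 0 < m) (hk : 0 < k) (hn : n = 0)
    (w : Fin (k * (16 * m)) → Bool) :
    ∃ z ∈ (closestString A n k m c).strings, 0 < hammingDist (β := fun _ => Bool) w z := by
  obtain ⟨x, hx, hxw⟩ := exists_testBit_eq (16 * m) (block w 0)
  refine ⟨_, mem_strings.2 ⟨0, hk, 0, hk, x, hx, x, hx, Or.inr hn,
    fun u hu => by omega, 0, by omega, rfl⟩, ?_⟩
  rw [hammingDist_eq_sum w (letter 0 0 x x 0)]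
  refine lt_of_lt_of_le ?_ (Finset.single_le_sum (fun _ _ => Nat.zero_le _)
    (Finset.mem_range.2 hk))
  have h1 : letter 0 0 x x 0 0 = fun q => !x.testBit q := by ext; simp [letter]
  have h2 := ham_add_ham_not (16 * m) (block w 0) x.testBit
  rw [ham_congr (fun _ _ => rfl) hxw, ham_self] at h2
  rw [h1]
  omega

theorem exists_far (hm : 0 < m) (hk : 0 < k)
    (hdist : ∀ a < n, ∀ b < n, a ≠ b → 2 * m ≤ ham (16 * m) (c a) (c b))
    (hA : ¬ ∃ v : ℕ → ℕ, (∀ i < k, v i < n) ∧ ∀ i < k, ∀ j < k, i < j → A (v i) (v j))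
    (w : Fin (closestString A n k m c).len → Bool) :
    ∃ z ∈ (closestString A n k m c).strings,
      (hammingDist w z : ℝ) >
        (1 + 1 / (((24 : ℕ) : ℝ) * (k : ℝ))) * ((closestString A n k m c).dist : ℝ) := by
  rcases Nat.eq_zero_or_pos n with hn | hn
  · obtain ⟨z, hz, h⟩ := exists_far_of_eq_zero (A := A) (c := c) hm hk hn w
    refine ⟨z, hz, ?_⟩
    have hd : (closestString A n k m c).dist = 0 := if_pos hn
    rw [hd, Nat.cast_zero, mul_zero]
    exact_mod_cast h
  suffices h : ∃ z ∈ (closestString A n k m c).strings, 8 * m * k + 16 * m ≤ hammingDist w z by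
    obtain ⟨z, hz, h⟩ := h
    refine ⟨z, hz, ?_⟩
    have hd : (closestString A n k m c).dist = 8 * m * k + 15 * m := if_neg hn.ne'
    have h' : ((8 * m * k + 16 * m : ℕ) : ℝ) ≤ hammingDist w z := Nat.cast_le.2 h
    rw [hd]
    refine lt_of_lt_of_le ?_ h'
    have hk' : (1 : ℝ) ≤ k := by exact_mod_cast hk
    have hm' : (0 : ℝ) < m := by exact_mod_cast hm
    -- Since `k ≥ 1`, the target distance is at most `23 * m * k`, which explains the constant 24.
    have : (1 : ℝ) / (24 * k) * (8 * m * k + 15 * m) < m := by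
      rw [div_mul_eq_mul_div, div_lt_iff₀ (by positivity)]
      nlinarith
    push_cast
    linarith
  by_contra! hno
  apply hA
  have hpair : ∀ i < k, ∀ j < k, i < j → ∃ u < n, ∃ v < n, A u v ∧
      ham (16 * m) (block w i) (c u) < m ∧ ham (16 * m) (block w j) (c v) < m := by
    intro i hi j hj hij
    obtain ⟨x, hx, hxw⟩ := exists_testBit_eq (16 * m) (block w i)
    obtain ⟨y, hy, hyw⟩ := exists_testBit_eq (16 * m) (block w j)
    by_contra! h
    obtain ⟨z, hz, hz'⟩ := exists_far_of_incompatible (A := A) (n := n) (c := c) w hi hj hij hx hy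
      hxw hyw (by
        intro u hu v hv huv
        have := h u hu v hv huv
        rw [ham_congr hxw fun _ _ => rfl, ham_congr hyw fun _ _ => rfl]
        omega)
    exact absurd hz' (not_le.2 (hno z hz))
  have huniq : ∀ i, ∀ u < n, ∀ v < n, ham (16 * m) (block w i) (c u) < m →
      ham (16 * m) (block w i) (c v) < m → u = v := by
    intro i u hu v hv h1 h2
    by_contra huv
    have h3 := hdist u hu v hv huv
    have h4 := ham_triangle (16 * m) (c u) (block w i) (c v)
    rw [ham_comm _ (c u) (block w i)] at h4
    omega
  -- A block near no code word gets the default vertex 0. For `i < k` this can happen only if `k =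
  -- 1`, where no adjacency is required.
  have hchoose : ∀ i, ∃ u < n, ∀ v < n, ham (16 * m) (block w i) (c v) < m → u = v := by
    intro i
    by_cases h : ∃ u < n, ham (16 * m) (block w i) (c u) < m
    · obtain ⟨u, hu, hu'⟩ := h
      exact ⟨u, hu, fun v hv hv' => huniq i u hu v hv hu' hv'⟩
    · exact ⟨0, hn, fun v hv hv' => absurd ⟨v, hv, hv'⟩ h⟩
  choose v hv hv' using hchoose
  refine ⟨v, fun i _ => hv i, fun i hi j hj hij => ?_⟩
  obtain ⟨a, ha, b, hb, hab, h1, h2⟩ := hpair i hi j hj hij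
  rwa [hv' i a ha h1, hv' j b hb h2]

end

end CliqueReduction

namespace CliqueReduction

open SuccRAM

/-! ### The reduction on the machine -/

section
variable {Γ : Type} [Ctx Γ]

theorem comp_ite_toNat {p : Γ → Prop} [∀ γ, Decidable (p γ)] {f g : Γ → Bool} (hp : CompP p)
    (hf : Comp fun γ => (f γ).toNat) (hg : Comp fun γ => (g γ).toNat) :
    Comp (fun γ => (if p γ then f γ else g γ).toNat) :=
  (Comp.ite hp hf hg).of_eq fun γ => by split_ifs <;> rfl

theorem comp_not_toNat {f : Γ → Bool} (hf : Comp fun γ => (f γ).toNat) :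
    Comp (fun γ => (!f γ).toNat) :=
  (Comp.sub (.const 1) hf).of_eq fun γ => by cases f γ <;> rfl

theorem comp_ham {l : Γ → ℕ} {f g : Γ → ℕ → Bool} (hl : Comp l)
    (hf : Comp fun p : Γ × ℕ => (f p.1 p.2).toNat) (hg : Comp fun p : Γ × ℕ => (g p.1 p.2).toNat) :
    Comp (fun γ => ham (l γ) (f γ) (g γ)) := by
  refine (Comp.sum_range (g := fun γ j => if (f γ j).toNat ≠ (g γ j).toNat then 1 else 0) hl
    (Comp.ite (CompP.ne hf hg) (.const 1) (.const 0))).of_eq fun γ => ?_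
  rw [ham_eq_sum]
  refine Finset.sum_congr rfl fun j _ => ?_
  cases f γ j <;> cases g γ j <;> simp

theorem comp_hash {N s a : Γ → ℕ} (hN : Comp N) (hs : Comp s) (ha : Comp a) :
    Comp (fun γ => hash (N γ) (s γ) (a γ)) :=
  ((((hs.div hN).mod hN).mul ha).add ((hs.div hN).div hN)).mod (hs.mod hN)

theorem compP_goodSeed {n m N s : Γ → ℕ} (hn : Comp n) (hm : Comp m) (hN : Comp N) (hs : Comp s) :
    CompP (fun γ => GoodSeed (n γ) (m γ) (N γ) (s γ)) := by
  refine CompP.forall_lt hn (CompP.forall_lt hn.fst ?_)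
  refine CompP.imp (CompP.ne Comp.snd.fst .snd) (CompP.le hm.fst.fst (comp_ham ?_ ?_ ?_))
  · exact (Comp.const 8).mul hm.fst.fst
  · exact Comp.testBit (comp_hash hN.fst.fst.fst hs.fst.fst.fst Comp.snd.fst.fst) .snd
  · exact Comp.testBit (comp_hash hN.fst.fst.fst hs.fst.fst.fst Comp.snd.fst) .snd

theorem comp_code {l N s a j : Γ → ℕ} (hl : Comp l) (hN : Comp N) (hs : Comp s) (ha : Comp a)
    (hj : Comp j) : Comp (fun γ => (code (l γ) (N γ) (s γ) (a γ) (j γ)).toNat) :=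
  comp_ite_toNat (CompP.lt hj hl) (Comp.testBit (comp_hash hN hs ha) hj)
    (comp_not_toNat (Comp.testBit (comp_hash hN hs ha) (hj.sub hl)))

theorem comp_letter {i j x y b r q : Γ → ℕ} (hi : Comp i) (hj : Comp j) (hx : Comp x)
    (hy : Comp y) (hb : Comp b) (hr : Comp r) (hq : Comp q) :
    Comp (fun γ => (letter (i γ) (j γ) (x γ) (y γ) (b γ) (r γ) (q γ)).toNat) :=
  comp_ite_toNat (CompP.eq hr hi) (comp_not_toNat (hx.testBit hq))
    (comp_ite_toNat (CompP.eq hr hj) (comp_not_toNat (hy.testBit hq)) (hb.testBit (.const 0)))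

/-- The adjacency relation given by a table that holds a matrix with rows of length `n`. -/
def tableAdj (T : ℕ → ℕ) (n u v : ℕ) : Prop := T (u * n + v) = 1

theorem compP_incompatible {n m N s x y : Γ → ℕ} (hn : Comp n) (hm : Comp m) (hN : Comp N)
    (hs : Comp s) (hx : Comp x) (hy : Comp y) :
    CompP (fun γ => Incompatible (tableAdj (Ctx.table γ) (n γ)) (n γ) (m γ)
      (code (8 * m γ) (N γ) (s γ)) (x γ) (y γ)) := by
  have hl : Comp fun γ => 16 * m γ := (Comp.const 16).mul hm
  refine CompP.forall_lt hn (CompP.forall_lt hn.fst (CompP.imp ?_ (CompP.le hm.fst.fst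
    (Comp.add (comp_ham hl.fst.fst ?_ ?_) (comp_ham hl.fst.fst ?_ ?_)))))
  · exact CompP.eq (Comp.table ((Comp.snd.fst.mul hn.fst.fst).add .snd)) (.const 1)
  · exact Comp.testBit hx.fst.fst.fst .snd
  · exact comp_code ((Comp.const 8).mul hm.fst.fst.fst) hN.fst.fst.fst hs.fst.fst.fst
      Comp.snd.fst.fst .snd
  · exact Comp.testBit hy.fst.fst.fst .snd
  · exact comp_code ((Comp.const 8).mul hm.fst.fst.fst) hN.fst.fst.fst hs.fst.fst.fst
      Comp.snd.fst .snd

open Classical in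
/-- The encoding of the constructed instance, written as nested loops. -/
theorem encode_closestString (A : ℕ → ℕ → Prop) (n k m : ℕ) (c : ℕ → ℕ → Bool) :
    (closestString A n k m c).encode = k * (16 * m) :: (if n = 0 then 0 else 8 * m * k + 15 * m) ::
      (List.range k).flatMap fun i => (List.range k).flatMap fun j =>
        (List.range (2 ^ (16 * m))).flatMap fun x => (List.range (2 ^ (16 * m))).flatMap fun y =>
          if (i < j ∨ n = 0) ∧ Incompatible A n m c x y then
            (List.range 2).flatMap fun b => ((List.range (k * (16 * m))).flatMap fun t =>
              [(letter i j x y b (t / (16 * m)) (t % (16 * m))).toNat]) ++ [2]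
          else [] := by
  have h (l : ℕ) (f : ℕ → ℕ) : List.ofFn (fun t : Fin l => f t) =
      (List.range l).flatMap fun t => [f t] := by
    rw [List.ofFn_eq_map, ← List.map_coe_finRange_eq_range, List.flatMap_map]
    induction List.finRange l with
    | nil => rfl
    | cons a L ih => rw [List.map_cons, List.flatMap_cons, ih, List.singleton_append]
  simp only [ClosestStringInstance.encode, closestString, strings, List.flatMap_assoc]
  congr! 10
  rename_i i j x y
  split_ifs
  · rw [List.flatMap_map]
    congr! 3 with b
    exact h _ fun t => (letter i j x y b (t / (16 * m)) (t % (16 * m))).toNat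
  · rfl

end

/-- An instance of Clique. -/
structure CliqueInstance where
  n : ℕ
  graph : SimpleGraph (Fin n)
  k : ℕ

noncomputable instance : Ctx CliqueInstance where
  depth := 2
  val γ := (cliqueInput γ.graph γ.k).reg
  table γ := (cliqueInput γ.graph γ.k).mem 0
  size γ := γ.n + γ.k
  val_le γ i hi := by
    simp only [cliqueInput]
    split_ifs <;> omega
  table_le γ a := by
    simp only [cliqueInput]
    split_ifs <;> omega

/-! ### Parameters, computability and correctness for a Clique instance -/

namespace CliqueInstance

theorem comp_n : Comp CliqueInstance.n :=
  (Comp.val (Γ := CliqueInstance) (i := 0) Nat.zero_lt_two).of_eq fun _ => rfl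

theorem comp_k : Comp CliqueInstance.k :=
  (Comp.val (Γ := CliqueInstance) (i := 1) Nat.one_lt_two).of_eq fun _ => rfl

/-- The distance parameter of the code. -/
def m (γ : CliqueInstance) : ℕ := γ.n.size + 1

/-- The number of strings of half the length of the code. -/
def N (γ : CliqueInstance) : ℕ := 2 ^ (8 * γ.m)

/-- The seed of the code. -/
noncomputable def seed (γ : CliqueInstance) : ℕ := least (γ.N ^ 3) (GoodSeed γ.n γ.m γ.N)

theorem comp_m : Comp m := comp_n.size.succ

/-- For fixed `e` this is the `e`-th power of `2 * 2 ^ n.size`, which is linear in `n`; hence all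
words of this length can be enumerated. -/
theorem comp_two_pow (e : ℕ) : Comp fun γ : CliqueInstance => 2 ^ (e * γ.m) :=
  (((Comp.const 2).mul comp_n.two_pow_size).pow e).of_eq fun γ => by
    rw [m, mul_comm e, pow_mul, pow_succ']

theorem comp_N : Comp N := comp_two_pow 8

theorem comp_seed : Comp seed :=
  Comp.least (comp_N.pow 3) (compP_goodSeed comp_n.fst comp_m.fst comp_N.fst .snd)

theorem goodSeed_seed (γ : CliqueInstance) : GoodSeed γ.n γ.m γ.N γ.seed := by
  refine least_spec (exists_goodSeed (Nat.succ_pos _) ?_)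
  have := Nat.lt_size_self γ.n
  rw [m, pow_succ]
  omega

/-- The adjacency relation of the vertices, as numbers. -/
noncomputable def adj (γ : CliqueInstance) : ℕ → ℕ → Prop := tableAdj (Ctx.table γ) γ.n

theorem adj_iff (γ : CliqueInstance) (u v : Fin γ.n) : γ.adj u v ↔ γ.graph.Adj u v := by
  classical
  change (if 0 = 0 ∧ ∃ u' v' : Fin γ.n, γ.graph.Adj u' v' ∧ (u * γ.n + v : ℕ) = u' * γ.n + v'
    then 1 else 0) = 1 ↔ _
  constructor
  · intro h
    split_ifs at h with h'
    obtain ⟨-, u', v', huv, h⟩ := h'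
    have e1 := congrArg (· / γ.n) h
    have e2 := congrArg (· % γ.n) h
    have hn : 0 < γ.n := u.pos
    simp only [mul_comm _ γ.n, Nat.mul_add_div hn, Nat.mul_add_mod, Nat.div_eq_of_lt v.2,
      Nat.div_eq_of_lt v'.2, Nat.mod_eq_of_lt v.2, Nat.mod_eq_of_lt v'.2, add_zero] at e1 e2
    rwa [Fin.ext e1, Fin.ext e2]
  · exact fun h => if_pos ⟨rfl, u, v, h, rfl⟩

/-- The instance of Closest String constructed from an instance of Clique. -/
noncomputable def toClosestString (γ : CliqueInstance) : ClosestStringInstance :=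
  closestString γ.adj γ.n γ.k γ.m (code (8 * γ.m) γ.N γ.seed)

theorem prints_toClosestString : Prints fun γ => (toClosestString γ).encode := by
  classical
  refine Prints.of_eq ?_ fun γ => (encode_closestString _ _ _ _ _).symm
  have hl : Comp fun γ => 16 * m γ := (Comp.const 16).mul comp_m
  have hX := comp_two_pow 16
  refine Prints.cons (comp_k.mul hl) (Prints.cons (Comp.ite (CompP.eq comp_n (.const 0)) (.const 0)
    ((((Comp.const 8).mul comp_m).mul comp_k).add ((Comp.const 15).mul comp_m))) ?_)
  refine Prints.flatMap_range comp_k (Prints.flatMap_range comp_k.fst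
    (Prints.flatMap_range hX.fst.fst (Prints.flatMap_range hX.fst.fst.fst
      (Prints.ite (CompP.and ?_ ?_) (Prints.flatMap_range (.const 2) (Prints.append
        (Prints.flatMap_range ?_ (.singleton ?_)) (.singleton (.const 2)))) .nil))))
  · exact CompP.or (CompP.lt Comp.snd.fst.fst.fst Comp.snd.fst.fst)
      (CompP.eq comp_n.fst.fst.fst.fst (.const 0))
  · exact compP_incompatible comp_n.fst.fst.fst.fst comp_m.fst.fst.fst.fst comp_N.fst.fst.fst.fst
      comp_seed.fst.fst.fst.fst Comp.snd.fst .snd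
  · exact (comp_k.mul hl).fst.fst.fst.fst.fst
  · exact comp_letter Comp.snd.fst.fst.fst.fst.fst Comp.snd.fst.fst.fst.fst Comp.snd.fst.fst.fst
      Comp.snd.fst.fst Comp.snd.fst (Comp.snd.div hl.fst.fst.fst.fst.fst.fst)
      (Comp.snd.mod hl.fst.fst.fst.fst.fst.fst)

theorem exists_close_of_clique (γ : CliqueInstance)
    (h : ∃ K : Finset (Fin γ.n), γ.graph.IsNClique γ.k K) :
    ∃ w : Fin γ.toClosestString.len → Bool, ∀ x ∈ γ.toClosestString.strings,
      hammingDist w x ≤ γ.toClosestString.dist := by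
  obtain ⟨K, hK⟩ := h
  have h16 : 16 * γ.m = 2 * (8 * γ.m) := by ring
  let f := K.orderEmbOfFin hK.card_eq
  refine exists_close (v := fun i => if h : i < γ.k then f ⟨i, h⟩ else 0)
    (fun a b => by rw [h16, ham_code_const]) (fun i hi => ?_) fun i hi j hj hij => ?_
  · simp [hi]
  · simp only [hi, hj, dif_pos]
    refine (γ.adj_iff _ _).2 (hK.isClique (K.orderEmbOfFin_mem hK.card_eq _)
      (K.orderEmbOfFin_mem hK.card_eq _) fun h => ?_)
    have := (K.orderEmbOfFin hK.card_eq).injective h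
    simp only [Fin.mk.injEq] at this
    omega

theorem exists_far_of_no_clique (γ : CliqueInstance)
    (h : ¬ ∃ K : Finset (Fin γ.n), γ.graph.IsNClique γ.k K)
    (w : Fin γ.toClosestString.len → Bool) : ∃ x ∈ γ.toClosestString.strings,
      (hammingDist w x : ℝ) >
        (1 + 1 / (((24 : ℕ) : ℝ) * (γ.k : ℝ))) * (γ.toClosestString.dist : ℝ) := by
  have h16 : 16 * γ.m = 2 * (8 * γ.m) := by ring
  refine exists_far (m := γ.m) (Nat.succ_pos _) ?_ (fun a ha b hb hab => ?_) ?_ w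
  · by_contra hk
    exact h ⟨∅, by simp [SimpleGraph.isNClique_iff]; omega⟩
  · rw [h16, ham_code]
    exact Nat.mul_le_mul_left 2 (γ.goodSeed_seed a ha b hb hab)
  · rintro ⟨v, hv, hA⟩
    have hadj : ∀ i j : Fin γ.k, i ≠ j → γ.graph.Adj ⟨v i, hv i i.2⟩ ⟨v j, hv j j.2⟩ := by
      intro i j hij
      rcases lt_or_gt_of_ne hij with hlt | hlt
      · exact (γ.adj_iff ⟨v i, hv i i.2⟩ ⟨v j, hv j j.2⟩).1 (hA i i.2 j j.2 hlt)
      · exact ((γ.adj_iff ⟨v j, hv j j.2⟩ ⟨v i, hv i i.2⟩).1 (hA j j.2 i i.2 hlt)).symm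
    refine h ⟨Finset.univ.image fun i : Fin γ.k => ⟨v i, hv i i.2⟩, ?_, ?_⟩
    · intro a ha b hb hab
      simp only [Finset.coe_image, Set.mem_image] at ha hb
      obtain ⟨i, -, rfl⟩ := ha
      obtain ⟨j, -, rfl⟩ := hb
      exact hadj i j fun e => hab (by rw [e])
    · rw [Finset.card_image_of_injective, Finset.card_univ, Fintype.card_fin]
      intro i j hij
      by_contra hne
      exact (hadj i j hne).ne hij

end CliqueInstance

/-- A power divided by an exponential tends to zero, hence is bounded; the shift by 2 costs a factor
4. -/
theorem exists_pow_le_mul_two_pow (B : ℕ) : ∃ C : ℕ, ∀ k : ℕ, (k + 2) ^ B ≤ C * 2 ^ k := by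
  obtain ⟨M, hM⟩ := (tendsto_pow_const_div_const_pow_of_one_lt B
    (one_lt_two : (1 : ℝ) < 2)).bddAbove_range
  refine ⟨⌈M * 4⌉₊, fun k => ?_⟩
  have h1 : ((k + 2 : ℕ) : ℝ) ^ B / 2 ^ (k + 2) ≤ M := hM ⟨k + 2, rfl⟩
  rw [div_le_iff₀ (by positivity), pow_add] at h1
  have h2 : M * 4 * 2 ^ k ≤ (⌈M * 4⌉₊ : ℝ) * 2 ^ k :=
    mul_le_mul_of_nonneg_right (Nat.le_ceil _) (by positivity)
  have h3 : ((k + 2 : ℕ) : ℝ) ^ B ≤ (⌈M * 4⌉₊ : ℝ) * 2 ^ k := by linarith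
  exact_mod_cast h3

end CliqueReduction

theorem theorem2 :
    ∃ c : ℕ, 0 < c ∧ ∃ (P : SuccRAM.Prog) (A : ℕ),
      ∀ (n : ℕ) (G : SimpleGraph (Fin n)) (k : ℕ),
        ∃ (I : ClosestStringInstance) (t : ℕ) (s : SuccRAM.State),
          SuccRAM.Run P (cliqueInput G k) t s ∧
          t ≤ A * 2 ^ k * (n + 1) ^ A ∧
          s.out = I.encode ∧
          ((∃ K : Finset (Fin n), G.IsNClique k K) →
            ∃ w : Fin I.len → Bool, ∀ x ∈ I.strings, hammingDist w x ≤ I.dist) ∧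
          ((¬ ∃ K : Finset (Fin n), G.IsNClique k K) →
            ∀ w : Fin I.len → Bool, ∃ x ∈ I.strings,
              (hammingDist w x : ℝ) > (1 + 1 / ((c : ℝ) * (k : ℝ))) * (I.dist : ℝ)) := by
  open CliqueReduction in
  -- The input occupies registers 0 and 1, so the scratch registers start at 2.
  obtain ⟨P, T, ⟨B, hB⟩, hP⟩ := CliqueInstance.prints_toClosestString id 2 fun i hi => hi
  obtain ⟨C, hC⟩ := exists_pow_le_mul_two_pow B
  refine ⟨24, by norm_num, P, B + C, fun n G k => ?_⟩
  obtain ⟨t, s, h1, h2, -, h3⟩ := hP ⟨n, G, k⟩ (cliqueInput G k) ⟨fun i _ => rfl, rfl⟩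
  refine ⟨CliqueInstance.toClosestString ⟨n, G, k⟩, t, s, h1, ?_, h3,
    CliqueInstance.exists_close_of_clique ⟨n, G, k⟩,
    CliqueInstance.exists_far_of_no_clique ⟨n, G, k⟩⟩
  calc t ≤ (n + k + 2) ^ B := h2.trans (hB _)
    _ ≤ ((k + 2) * (n + 1)) ^ B := Nat.pow_le_pow_left (by nlinarith) B
    _ = (k + 2) ^ B * (n + 1) ^ B := mul_pow _ _ _
    _ ≤ ((B + C) * 2 ^ k) * (n + 1) ^ (B + C) := by
      refine Nat.mul_le_mul ((hC k).trans (Nat.mul_le_mul_right _ (by omega)))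
        (Nat.pow_le_pow_right (by omega) (by omega))
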